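/- **Theorem.** Let $k$ be an algebraically closed field and $X$ a projective, irreducible, non-singular curve over $k$, with function field $\Sigma$. For a closed point $x$ of $X$ let $A_x$ be the completion of $\mathcal O_{X,x}$ with respect to its valuation, $\mathfrak m_x$ its maximal ideal and $K_x$ its quotient field. Let $\mathbb A_X$ be the adele ring, the restricted direct product of the $K_x$ with respect to the $A_x$ over all closed points $x$, with the restricted product topology, and let $\mathbb A_X^+=\prod_x A_x\subseteq\mathbb A_X$. Let $\mathbb p\in\mathbb A_X[T]$ be monic of degree $n$ and separable, i.e. $\mathbb A_X\{\mathbb p\}:=\mathbb A_X[T]/(\mathbb p)$ is a separable $\mathbb A_X$-algebra (projective as a module over $\mathbb A_X\{\mathbb p\}\otimes_{\mathbb A_X}\mathbb A_X\{\mathbb p\}$). Let $\mathbb A_X\{\mathbb p\}^+$ be the integral closure of $\mathbb A_X^+$ in $\mathbb A_X\{\mathbb p\}$. For each $x$ let $\mathbb p_x\in K_x[T]$ be the image of $\mathbb p$, let $\mathfrak B_x$ be the integral closure of $A_x$ in $K_x[T]/(\mathbb p_x)$, and let $\mathfrak n_x\subseteq\mathfrak B_x$ be the ideal of the elements of $K_x[T]/(\mathbb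 p_x)$ integral over $\mathfrak m_x$, i.e. annihilated by a monic polynomial over $A_x$ whose non-leading coefficients lie in $\mathfrak m_x$. Give $\mathbb A_X\{\mathbb p\}$ the adelic topology, i.e. the translation-invariant topology in which the sets $$U_D=\{\alpha\in\mathbb A_X\{\mathbb p\} : \alpha_x\in\mathfrak n_x^{k_x}\text{ for all }x\},\qquad D=\sum_x k_x\,x\ \text{ an effective divisor on } X,$$ are a neighbourhood basis at $0$, where $\alpha_x$ is the image of $\alpha$ in $K_x[T]/(\mathbb p_x)$. Two $k$-subspaces $U,V$ of a $k$-vector space are called commensurable if $\dim_k (U+V)/(U\cap V)<\infty$. Then: 1. $\mathbb A_X\{\mathbb p\}$ is a topological $\mathbb A_X$-module (it is a topological group and scalar multiplication $\mathbb A_X\times\mathbb A_X\{\mathbb p\}\to\mathbb A_X\{\mathbb p\}$ is jointly continuous) and its topology is $k$-linear. The closed $k$-subspaces of $\mathbb A_X\{\mathbb p\}$ that are commensurable with $\mathbb A_X\{\mathbb p\}^+$ are a neighbourhood basis at $0$. 2. The map $\psi:\mathbb A_X\{\mathbb p\}\to\mathbb A_X^{\oplus n}$ sending the class of $Q\in\mathbb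 A_X[T]$ to the coefficients (of $1,T,\dots,T^{n-1}$) of the remainder of $Q$ on division by $\mathbb p$ is well defined, and it is an isomorphism of $\mathbb A_X$-modules and a homeomorphism. Hence $\mathbb A_X\{\mathbb p\}\simeq\mathbb A_X^{\oplus n}$ as linear topological $\mathbb A_X$-modules. 3. The map $\psi$ is also a homeomorphism if $\mathbb A_X\{\mathbb p\}$ is given the topology with all $k$-subspaces commensurable with $\mathbb A_X\{\mathbb p\}^+$ as neighbourhood basis at $0$, and $\mathbb A_X^{\oplus n}$ the product of the topologies on $\mathbb A_X$ with all $k$-subspaces commensurable with $\mathbb A_X^+$ as neighbourhood basis at $0$. -/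

import Mathlib

open CategoryTheory AlgebraicGeometry IsDedekindDomain
open scoped RestrictedProduct TensorProduct Topology

universe u

/-! ## Curves -/

section Curves

attribute [local instance] MvPolynomial.gradedAlgebra

/-- Projective space of dimension `m` over `k`. -/
noncomputable def projSpace (k : Type u) [Field k] (m : ℕ) : Scheme.{u} :=
  Proj (MvPolynomial.homogeneousSubmodule (Fin (m + 1)) k)

/-- The structure morphism of projective space over `k`. -/
noncomputable def projSpaceToSpec (k : Type u) [Field k] (m : ℕ) :
    projSpace k m ⟶ Spec (.of k) :=
  Proj.toSpecZero (MvPolynomial.homogeneousSubmodule (Fin (m + 1)) k) ≫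
    Spec.map (CommRingCat.ofHom
      (algebraMap k (MvPolynomial.homogeneousSubmodule (Fin (m + 1)) k 0)))

end Curves

/-- A `k`-scheme is projective if it is a closed subscheme of some projective space over `k`. -/
def IsProjectiveOver (k : Type u) [Field k] (X : Scheme.{u}) [X.Over (Spec (.of k))] : Prop :=
  ∃ (m : ℕ) (i : X ⟶ projSpace k m),
    IsClosedImmersion i ∧ i ≫ projSpaceToSpec k m = X ↘ Spec (.of k)

/-- Integral schemes of dimension one all of whose local rings are regular. -/
class IsNonsingularCurve (X : Scheme.{u}) : Prop extends IsIntegral X where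
  dim_eq_one : topologicalKrullDim X = 1
  isRegularLocalRing_stalk : ∀ x : X, IsRegularLocalRing (X.presheaf.stalk x)

/-- The closed points of a scheme. -/
abbrev ClosedPoint (X : Scheme.{u}) : Type u := {x : X // IsClosed ({x} : Set X)}

theorem IsNonsingularCurve.coheight_eq_one (X : Scheme.{u}) [IsNonsingularCurve X]
    (x : ClosedPoint X) : Order.coheight x.1 = 1 := by
  have hdim : Order.krullDim X = 1 := by
    rw [← IsNonsingularCurve.dim_eq_one (X := X), topologicalKrullDim]
    exact (Order.krullDim_eq_of_orderIso (irreducibleSetEquivPoints (α := X))).symm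
  have hle : Order.coheight x.1 ≤ 1 := by
    have := Order.coheight_le_krullDim x.1
    rw [hdim] at this
    exact_mod_cast this
  refine le_antisymm hle ?_
  rw [Order.one_le_iff_ne_zero]
  intro h0
  rw [Order.coheight_eq_zero] at h0
  have hg : genericPoint X ≤ x.1 := h0 (genericPoint_specializes x.1)
  have hsub : ∀ y : X, y = x.1 := by
    intro y
    have h1 : x.1 ⤳ y := (show x.1 ⤳ genericPoint X from hg).trans (genericPoint_specializes y)
    have h2 : y ∈ closure ({x.1} : Set X) := specializes_iff_mem_closure.mp h1
    rwa [x.2.closure_eq] at h2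
  have : Subsingleton X := ⟨fun a b => (hsub a).trans (hsub b).symm⟩
  have h3 : Order.krullDim X ≤ 0 := Order.krullDim_nonpos_of_subsingleton
  rw [hdim] at h3
  exact absurd h3 (by norm_num)

instance IsNonsingularCurve.isDiscreteValuationRing_stalk (X : Scheme.{u}) [IsNonsingularCurve X]
    (x : ClosedPoint X) : IsDiscreteValuationRing (X.presheaf.stalk x.1) := by
  have hr := IsNonsingularCurve.isRegularLocalRing_stalk x.1
  have hd : ringKrullDim (X.presheaf.stalk x.1) = 1 := by
    rw [ringKrullDim_stalk_eq_coheight, IsNonsingularCurve.coheight_eq_one]; rfl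
  have hf : ¬ IsField (X.presheaf.stalk x.1) := by
    intro h
    rw [ringKrullDim_eq_zero_of_isField h] at hd
    exact absurd hd (by norm_num)
  refine ((IsDiscreteValuationRing.TFAE _ hf).out 0 5).mpr ?_
  have := (IsRegularLocalRing.iff_finrank_cotangentSpace _).mp hr
  rw [hd] at this
  exact_mod_cast this

/-! ## Adeles -/

section Adeles

variable (X : Scheme.{u}) [IsNonsingularCurve X]

/-- The place of the function field at a closed point `x`: the maximal ideal of `𝒪_x`. -/
noncomputable abbrev place (x : ClosedPoint X) : HeightOneSpectrum (X.presheaf.stalk x.1) :=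
  IsDiscreteValuationRing.maximalIdeal (X.presheaf.stalk x.1)

/-- `K_x`: the completion of the function field with respect to the valuation at `x`. -/
noncomputable abbrev LocalField (x : ClosedPoint X) : Type u :=
  (place X x).adicCompletion X.functionField

/-- `A_x`: the valuation ring of `K_x`, i.e. the completion of `𝒪_x`. -/
noncomputable abbrev localIntegers (x : ClosedPoint X) : ValuationSubring (LocalField X x) :=
  (place X x).adicCompletionIntegers X.functionField

/-- The adele ring `𝔸_X`, the restricted direct product of the `K_x` with respect to the `A_x`
over the closed points, with the restricted product topology. -/
noncomputable abbrev Adele : Type u :=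
  Πʳ x : ClosedPoint X, [LocalField X x, localIntegers X x]

/-- The projection `𝔸_X → K_x`. -/
noncomputable abbrev Adele.eval (x : ClosedPoint X) : Adele X →+* LocalField X x :=
  RestrictedProduct.evalRingHom (LocalField X) x

/-- `𝔸_X⁺`, the product of the `A_x`. -/
noncomputable def integralAdele : Subring (Adele X) :=
  ⨅ x : ClosedPoint X, (localIntegers X x).toSubring.comap (Adele.eval X x)

theorem mem_integralAdele {a : Adele X} :
    a ∈ integralAdele X ↔ ∀ x, a x ∈ localIntegers X x := by
  simp only [integralAdele, Subring.mem_iInf, Subring.mem_comap]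
  rfl

end Adeles

section Constants

variable (k : Type u) [Field k] (X : Scheme.{u}) [X.Over (Spec (.of k))]

/-- The structure map `k → 𝒪_x`. -/
noncomputable def constToStalk (x : X) : k →+* X.presheaf.stalk x :=
  ((X.presheaf.germ ⊤ x trivial).hom.comp ((X ↘ Spec (.of k)).appTop).hom).comp
    (Scheme.ΓSpecIso (.of k)).inv.hom

variable [IsNonsingularCurve X]

/-- The diagonal embedding of the constants `k` in `𝔸_X`. -/
noncomputable def constToAdele : k →+* Adele X where
  toFun c := ⟨fun x => algebraMap (X.presheaf.stalk x.1) (LocalField X x) (constToStalk k X x.1 c),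
    Filter.Eventually.of_forall fun x =>
      (algebraMap (X.presheaf.stalk x.1) (localIntegers X x) (constToStalk k X x.1 c)).2⟩
  map_one' := RestrictedProduct.ext _ _ fun x => by simp
  map_mul' a b := RestrictedProduct.ext _ _ fun x => by
    simp only [RestrictedProduct.mk_apply, map_mul]
    rfl
  map_zero' := RestrictedProduct.ext _ _ fun x => by simp
  map_add' a b := RestrictedProduct.ext _ _ fun x => by
    simp only [RestrictedProduct.mk_apply, map_add]
    rfl

noncomputable instance Adele.instAlgebraConst : Algebra k (Adele X) :=
  (constToAdele k X).toAlgebra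

theorem constToAdele_mem_integralAdele (c : k) : algebraMap k (Adele X) c ∈ integralAdele X :=
  (mem_integralAdele X).mpr fun x =>
    (algebraMap (X.presheaf.stalk x.1) (localIntegers X x) (constToStalk k X x.1 c)).2

/-- `𝔸_X⁺` as a `k`-subspace of `𝔸_X`. -/
noncomputable def integralAdeleSubspace : Submodule k (Adele X) where
  carrier := integralAdele X
  zero_mem' := zero_mem _
  add_mem' := add_mem
  smul_mem' c a ha := by
    rw [Algebra.smul_def]
    exact mul_mem (constToAdele_mem_integralAdele k X c) ha

end Constants

/-! ## Separability, commensurability, topologies given by subgroups -/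

/-- A commutative `R`-algebra `A` is separable if it is projective as an `A ⊗[R] A`-module
(through the multiplication map `A ⊗[R] A → A`). -/
def IsSeparableAlgebra (R A : Type*) [CommRing R] [CommRing A] [Algebra R A] : Prop :=
  letI : Module (A ⊗[R] A) A := Module.compHom A (Algebra.TensorProduct.lmul' R (S := A)).toRingHom
  Module.Projective (A ⊗[R] A) A

/-- A monic polynomial over `R` is separable if `R[T]/(P)` is a separable `R`-algebra. -/
def IsSeparablePolynomial {R : Type*} [CommRing R] (P : Polynomial R) : Prop :=
  IsSeparableAlgebra R (AdjoinRoot P)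

/-- Subspaces `U`, `V` are commensurable if `(U + V) / (U ∩ V)` is finite-dimensional. -/
def IsCommensurable {k M : Type*} [Field k] [AddCommGroup M] [Module k M]
    (U V : Submodule k M) : Prop :=
  FiniteDimensional k (↥(U ⊔ V) ⧸ (U ⊓ V).submoduleOf (U ⊔ V))

/-- The topology on an abelian group generated by the cosets of the subgroups in `𝓑`. If `𝓑` is
nonempty and downward directed, this is the group topology with `𝓑` as neighbourhood basis
at `0`. -/
def topologyOfSubgroups {G : Type*} [AddCommGroup G] (𝓑 : Set (AddSubgroup G)) :
    TopologicalSpace G :=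
  TopologicalSpace.generateFrom {s | ∃ U ∈ 𝓑, ∃ a : G, s = {g | g - a ∈ U}}

/-- The topology with the subspaces commensurable with `V` as neighbourhood basis at `0`. -/
def commensurabilityTopology {k M : Type*} [Field k] [AddCommGroup M] [Module k M]
    (V : Submodule k M) : TopologicalSpace M :=
  topologyOfSubgroups {W | ∃ U : Submodule k M, IsCommensurable U V ∧ U.toAddSubgroup = W}

/-! ## Adelic algebras `𝔸_X{p} = 𝔸_X[T]/(p)`, as `AdjoinRoot p` -/

section AdelicAlgebra

variable {X : Scheme.{u}} [IsNonsingularCurve X] (p : Polynomial (Adele X))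

/-- `p_x ∈ K_x[T]`. -/
noncomputable abbrev localPoly (x : ClosedPoint X) : Polynomial (LocalField X x) :=
  p.map (Adele.eval X x)

/-- The map `𝔸_X{p} → K_x{p_x}`, `α ↦ α_x`. -/
noncomputable def toLocal (x : ClosedPoint X) : AdjoinRoot p →+* AdjoinRoot (localPoly p x) :=
  AdjoinRoot.map (Adele.eval X x) p (localPoly p x) dvd_rfl

/-- `𝔅_x`, the integral closure of `A_x` in `K_x{p_x}`. -/
noncomputable abbrev localClosure (x : ClosedPoint X) :
    Subalgebra (localIntegers X x) (AdjoinRoot (localPoly p x)) :=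
  integralClosure (localIntegers X x) (AdjoinRoot (localPoly p x))

/-- `𝔫_x`, the integral closure of the maximal ideal `𝔪_x` of `A_x` in `K_x{p_x}`, as an ideal
of `𝔅_x`. It is the radical of `𝔪_x 𝔅_x`; see `mem_localIdeal_iff` for its description as the set
of the elements that are integral over `𝔪_x`. -/
noncomputable def localIdeal (x : ClosedPoint X) : Ideal (localClosure p x) :=
  ((IsLocalRing.maximalIdeal (localIntegers X x)).map
    (algebraMap (localIntegers X x) (localClosure p x))).radical

theorem mem_localIdeal_iff (x : ClosedPoint X) (b : localClosure p x) :
    b ∈ localIdeal p x ↔ ∃ q : Polynomial (localIntegers X x), q.Monic ∧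
      (∀ i ≠ q.natDegree, q.coeff i ∈ IsLocalRing.maximalIdeal (localIntegers X x)) ∧
      Polynomial.aeval (b : AdjoinRoot (localPoly p x)) q = 0 := by
  constructor
  · rintro ⟨n, hn⟩
    have hn' := Ideal.mul_mem_right b _ hn
    rw [← pow_succ] at hn'
    obtain ⟨q, hq, e, h⟩ := Polynomial.exists_monic_aeval_eq_zero_forall_mem_of_mem_map hn'
    refine ⟨Polynomial.expand _ (n + 1) q, hq.expand n.succ_pos, fun i hi => ?_, ?_⟩
    · rw [Polynomial.coeff_expand n.succ_pos]
      split_ifs with hd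
      · refine h _ fun h' => hi ?_
        rw [Polynomial.natDegree_expand, ← h', Nat.div_mul_cancel hd]
      · exact zero_mem _
    · rw [Polynomial.expand_aeval]
      have := congrArg (localClosure p x).val e
      rwa [← Polynomial.aeval_algHom_apply, map_zero, map_pow] at this
  · rintro ⟨q, hq, h, e⟩
    refine ⟨q.natDegree, ?_⟩
    have e' : Polynomial.aeval b q = 0 := Subtype.ext (by
      rw [← Subalgebra.coe_val, ← Polynomial.aeval_algHom_apply]; exact e)
    rw [Polynomial.aeval_eq_sum_range, Finset.sum_range_succ, hq.coeff_natDegree, one_smul,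
      add_comm, ← eq_neg_iff_add_eq_zero] at e'
    rw [e']
    refine neg_mem (sum_mem fun i hi => ?_)
    rw [Algebra.smul_def]
    exact Ideal.mul_mem_right _ _ (Ideal.mem_map_of_mem _ (h i (Finset.mem_range.mp hi).ne))

/-- `U_D`, the product of the `𝔫_x ^ k_x`, for an effective divisor `D = ∑ k_x x`. -/
noncomputable def divisorSubgroup (D : ClosedPoint X →₀ ℕ) : AddSubgroup (AdjoinRoot p) :=
  ⨅ x : ClosedPoint X, (((localIdeal p x ^ D x).toAddSubgroup).map
    (localClosure p x).toSubring.subtype.toAddMonoidHom).comap (toLocal p x).toAddMonoidHom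

/-- The adelic topology on `𝔸_X{p}`, i.e. the restricted direct product topology with respect to
the `𝔫_x`-adic topologies: the `U_D` are a neighbourhood basis at `0`. -/
noncomputable instance adelicTopology : TopologicalSpace (AdjoinRoot p) :=
  topologyOfSubgroups (Set.range (divisorSubgroup p))

variable (k : Type u) [Field k] [X.Over (Spec (.of k))]

/-- `𝔸_X{p}⁺`, the integral closure of `𝔸_X⁺` in `𝔸_X{p}`, as a `k`-subspace. -/
noncomputable def integralSubspace : Submodule k (AdjoinRoot p) where
  carrier := integralClosure (integralAdele X) (AdjoinRoot p)
  zero_mem' := zero_mem _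
  add_mem' := add_mem
  smul_mem' c a ha := by
    rw [← algebraMap_smul (Adele X) c a]
    exact (integralClosure (integralAdele X) (AdjoinRoot p)).smul_mem ha
      (⟨algebraMap k (Adele X) c, constToAdele_mem_integralAdele k X c⟩ : integralAdele X)

end AdelicAlgebra

/-!
The coordinates of an element of `𝔸_X{p} = 𝔸_X[T]/(p)` with respect to `1, T, …, T ^ (n - 1)` are
the coefficients of the remainder on division by `p`; they define the linear isomorphism
`ψ = coordEquiv`. All topological claims follow from comparing, by means of ideles, three families
of subgroups of `𝔸_X{p}`: the lattices `ψ⁻¹((c 𝔸_X⁺)ⁿ)` for ideles `c` with integral components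
(`coordLattice`), the subgroups `U_D`, and the integral closure `𝔸_X{p}⁺`.

* Separability of the algebra gives `u p + v p' = 1` over `𝔸_X`
  (`IsSeparablePolynomial.separable`). Let `c` be a common denominator of the finitely many adeles
  involved in this identity. On the one hand, `c t` is integral over `𝔸_X⁺`. On the other hand, at
  each place the images of an integral element `b` under the embeddings in an algebraic closure of
  `K_x` are integral, and Lagrange interpolation at the roots of `p_x` recovers `p'_x b` from them;
  as `p'_x` is invertible, the coordinates of `b` have a power of `c_x` as denominator. So the
  lattice of integral coordinates and the integral closure agree up to ideles
  (`exists_integralIdele_bounds`), in particular exactly at almost all places.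
* At the remaining places `𝔅_x` is a Noetherian module over `A_x`, hence the powers of the radical
  `𝔫_x` of `𝔪_x 𝔅_x` shrink to `0`. Consequently the `U_D` and the lattices define the same topology
  (`exists_divisorSubgroup_le`, `exists_smul_mem_divisorSubgroup`). As the `c 𝔸_X⁺` are a
  neighbourhood basis at `0` in `𝔸_X` (`hasBasis_nhds_zero_adele`), `ψ` is a homeomorphism, and
  `𝔸_X{p}` inherits continuity of scalar multiplication and linearity of the topology.
* By the Nullstellensatz the residue fields of the curve are `k`, so `𝔸_X⁺ = c 𝔸_X⁺ + k` for an
  idele `c` that is a uniformizer at one place and trivial elsewhere. By multiplicativity all the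
  `c 𝔸_X⁺` are commensurable with `𝔸_X⁺` (`almostLE_map_mulLeft`), and all the lattices with
  `𝔸_X{p}⁺` (`isCommensurable_coordLattice`). Conversely, a closed subspace that contains an open
  one up to finite dimension is open (`Submodule.mem_nhds_zero_of_isClosed_of_almostLE`).
* For the topologies defined by commensurability alone, it is enough that a subspace of `Mⁿ`
  commensurable with `Vⁿ` contains a product of subspaces commensurable with `V`
  (`IsCommensurable.exists_pi_le`).
-/

/-! ### Separable polynomials -/

section Separability

open Polynomial

/-- The map `R[T]/(P) → (R[T]/(P, P'))[ε]`, `t ↦ t + ε`, exists since `P(t + ε) = P(t) + P'(t) ε`.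
The separability idempotent forces it to agree with `t ↦ t`, so that `(P, P')` is the unit ideal. -/
theorem IsSeparablePolynomial.separable {R : Type*} [CommRing R] {P : Polynomial R}
    (h : IsSeparablePolynomial P) : P.Separable := by
  let A := AdjoinRoot P
  let t : A := AdjoinRoot.root P
  let J : Ideal A := Ideal.span {AdjoinRoot.mk P (derivative P)}
  let B := A ⧸ J
  -- A section of the multiplication map gives the separability idempotent `e`.
  obtain ⟨e, he1, he2⟩ : ∃ e : A ⊗[R] A, Algebra.TensorProduct.lmul' R (S := A) e = 1 ∧
      ∀ a : A, (a ⊗ₜ[R] 1 - 1 ⊗ₜ[R] a) * e = 0 := by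
    let _ : Module (A ⊗[R] A) A :=
      Module.compHom A (Algebra.TensorProduct.lmul' R (S := A)).toRingHom
    have hproj : Module.Projective (A ⊗[R] A) A := h
    have hsmul (y : A ⊗[R] A) (a : A) : y • a = Algebra.TensorProduct.lmul' R (S := A) y * a := rfl
    let m : A ⊗[R] A →ₗ[A ⊗[R] A] A :=
      { toFun := Algebra.TensorProduct.lmul' R (S := A)
        map_add' := map_add _
        map_smul' := fun y z => by simp [hsmul] }
    obtain ⟨σ, hσ⟩ := Module.projective_lifting_property m LinearMap.id
      (fun a => ⟨a ⊗ₜ 1, by simp [m]⟩)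
    refine ⟨σ 1, LinearMap.congr_fun hσ 1, fun a => ?_⟩
    rw [← smul_eq_mul, ← map_smul, hsmul]
    simp
  -- The two `R`-algebra maps `t ↦ t` and `t ↦ t + ε` to the dual numbers over `B`; the image of `e`
  -- is killed by `ε` but is `1` modulo `ε`.
  let q : A →ₐ[R] B := Ideal.Quotient.mkₐ R J
  let φ : A →ₐ[R] DualNumber B := (TrivSqZeroExt.inlAlgHom R B B).comp q
  have hroot : aeval (φ t + DualNumber.eps) P = 0 := by
    rw [aeval_add_of_sq_eq_zero]
    · have h1 : aeval t P = 0 := AdjoinRoot.aeval_eq P ▸ AdjoinRoot.mk_self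
      have h2 : q (aeval t (derivative P)) = 0 := by
        rw [AdjoinRoot.aeval_eq]
        exact Ideal.Quotient.eq_zero_iff_mem.mpr (Ideal.mem_span_singleton_self _)
      rw [aeval_algHom_apply, aeval_algHom_apply, h1, map_zero, AlgHom.comp_apply, h2, map_zero,
        zero_mul, add_zero]
    · rw [sq, DualNumber.eps_mul_eps]
  let χ : A →ₐ[R] DualNumber B :=
    AdjoinRoot.liftAlgHom P (Algebra.ofId R _) (φ t + DualNumber.eps) hroot
  let Φ : A ⊗[R] A →ₐ[R] DualNumber B := Algebra.TensorProduct.lift φ χ fun _ _ => mul_comm _ _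
  have hΦ (a b : A) : Φ (a ⊗ₜ[R] b) = φ a * χ b := Algebra.TensorProduct.lift_tmul _ _ _ _ _
  have hχ : χ t = φ t + DualNumber.eps := AdjoinRoot.liftAlgHom_root _ _ _ _
  have hfst : (TrivSqZeroExt.fstHom R B B).comp Φ =
      q.comp (Algebra.TensorProduct.lmul' R (S := A)) := by
    ext
    · change TrivSqZeroExt.fst (Φ (t ⊗ₜ[R] 1)) = q (Algebra.TensorProduct.lmul' R (t ⊗ₜ[R] 1))
      rw [hΦ]
      simp [φ]
    · change TrivSqZeroExt.fst (Φ (1 ⊗ₜ[R] t)) = q (Algebra.TensorProduct.lmul' R (1 ⊗ₜ[R] t))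
      rw [hΦ, hχ]
      simp [φ]
  have hzero : Φ (t ⊗ₜ[R] 1 - 1 ⊗ₜ[R] t) * Φ e = 0 := by rw [← map_mul, he2, map_zero]
  have hB : (1 : B) = 0 := by
    have h1 : Φ (t ⊗ₜ[R] 1 - 1 ⊗ₜ[R] t) = -DualNumber.eps := by
      rw [map_sub, hΦ, hΦ, hχ]
      simp
    have h2 : TrivSqZeroExt.fst (Φ e) = 1 := by
      have := AlgHom.congr_fun hfst e
      simpa [he1] using this
    rw [h1] at hzero
    simpa [h2] using congrArg TrivSqZeroExt.snd hzero
  have htop : (1 : A) ∈ J := Ideal.Quotient.eq_zero_iff_mem.mp hB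
  obtain ⟨v, hv⟩ := Ideal.mem_span_singleton'.mp htop
  obtain ⟨V, rfl⟩ := AdjoinRoot.mk_surjective v
  rw [← map_mul, ← map_one (AdjoinRoot.mk P), AdjoinRoot.mk_eq_mk] at hv
  obtain ⟨u, hu⟩ := hv
  exact ⟨-u, V, by linear_combination hu⟩

end Separability

/-! ### Coordinates of integral elements -/

section Integrality

open Polynomial

/-- If `c` is a common denominator of the coefficients of the monic polynomial `p`, then `c s` is
integral for every root `s` of `p`. -/
theorem isIntegral_smul_root {A R S : Type*} [CommRing A] [CommRing R] [CommRing S]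
    [Algebra A R] [Algebra R S] [Algebra A S] [IsScalarTower A R S] {p : R[X]} (hp : p.Monic)
    (c : A) (hc : ∀ i, algebraMap A R c * p.coeff i ∈ (algebraMap A R).range) {s : S}
    (hs : aeval s p = 0) : _root_.IsIntegral A (c • s) := by
  nontriviality S
  have : Nontrivial R := (algebraMap R S).domain_nontrivial
  have hl : p.scaleRoots (algebraMap A R c) ∈ lifts (algebraMap A R) := by
    rw [lifts_iff_coeff_lifts]
    intro i
    rw [coeff_scaleRoots]
    rcases lt_trichotomy i p.natDegree with h | rfl | h
    · obtain ⟨a, ha⟩ := hc i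
      refine ⟨a * c ^ (p.natDegree - i - 1), ?_⟩
      rw [map_mul, ha, map_pow, mul_right_comm, ← pow_succ', mul_comm]
      congr 2
      omega
    · exact ⟨1, by simp [hp.coeff_natDegree]⟩
    · exact ⟨0, by simp [coeff_eq_zero_of_natDegree_lt h]⟩
  obtain ⟨q, hq, -, hqm⟩ := lifts_and_natDegree_eq_and_monic hl
    ((monic_scaleRoots_iff _).mpr hp)
  refine ⟨q, hqm, ?_⟩
  rw [← aeval_def, ← aeval_map_algebraMap R, hq, Algebra.smul_def,
    IsScalarTower.algebraMap_apply A R S]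
  exact scaleRoots_aeval_eq_zero hs

/-- If `b ∈ K[T]/(p)` is integral over `A`, then so are its images under all embeddings of
`K[T]/(p)` in an algebraic closure of `K`, and `p' b` is recovered from these by Lagrange
interpolation at the roots of `p`. Here `c` is a common denominator of the coefficients of `p`. -/
theorem pow_mul_coeff_derivative_mul_modByMonic_mem_range {A K : Type*} [CommRing A] [Field K]
    [Algebra A K] [IsIntegrallyClosedIn A K] {p : K[X]} (hp : p.Monic) (hsep : p.Separable)
    (c : A) (hc : ∀ i, algebraMap A K c * p.coeff i ∈ (algebraMap A K).range) {B : K[X]}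
    (hB : _root_.IsIntegral A (AdjoinRoot.mk p B)) (i : ℕ) :
    algebraMap A K c ^ (p.natDegree - 1) * ((derivative p * B) %ₘ p).coeff i ∈
      (algebraMap A K).range := by
  classical
  let Ω := AlgebraicClosure K
  let s : Finset Ω := (p.map (algebraMap K Ω)).roots.toFinset
  have hmem (r : Ω) : r ∈ s ↔ aeval r p = 0 := by
    rw [Multiset.mem_toFinset, mem_roots (hp.map _).ne_zero, IsRoot.def, eval_map_algebraMap]
  have hprod : p.map (algebraMap K Ω) = ∏ r ∈ s, (X - C r) := by
    have h1 := (IsAlgClosed.splits (p.map (algebraMap K Ω))).eq_prod_roots_of_monic (hp.map _)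
    conv_lhs => rw [h1]
    rw [Finset.prod, Multiset.toFinset_val,
      Multiset.dedup_eq_self.mpr (nodup_roots hsep.map)]
  have hcard : s.card = p.natDegree := by
    rw [← hp.natDegree_map (algebraMap K Ω), hprod, natDegree_prod_of_monic _ _
      fun r _ => monic_X_sub_C r]
    simp
  -- Both sides of the interpolation formula have degree less than `n` and agree at the roots.
  have hinterp : ((derivative p * B) %ₘ p).map (algebraMap K Ω) =
      ∑ r ∈ s, C (aeval r B) * ∏ r' ∈ s.erase r, (X - C r') := by
    refine eq_of_degrees_lt_of_eval_finset_eq s ?_ ?_ fun r hr => ?_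
    · rw [degree_map, hcard, ← degree_eq_natDegree hp.ne_zero]
      exact degree_modByMonic_lt _ hp
    · refine (degree_sum_le _ _).trans_lt ((Finset.sup_lt_iff (WithBot.bot_lt_coe _)).mpr ?_)
      intro r hr
      refine (degree_mul_le _ _).trans_lt ?_
      have h1 : (∏ r' ∈ s.erase r, (X - C r')).degree < (s.card : WithBot ℕ) := by
        rw [degree_prod]
        simp only [degree_X_sub_C, Finset.sum_const, Finset.card_erase_of_mem hr, nsmul_eq_mul,
          mul_one]
        exact_mod_cast Nat.sub_lt (Finset.card_pos.mpr ⟨r, hr⟩) one_pos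
      exact (add_le_add_left degree_C_le _).trans_lt (by rwa [zero_add])
    · have hr0 : aeval r p = 0 := (hmem r).mp hr
      have hd : aeval r (derivative p) = ∏ r' ∈ s.erase r, (r - r') := by
        rw [← eval_map_algebraMap, ← derivative_map, hprod, derivative_prod_finset, eval_finsetSum,
          Finset.sum_eq_single_of_mem r hr]
        · simp [eval_prod]
        · intro r' _ hne
          rw [eval_mul, eval_prod, Finset.prod_eq_zero (Finset.mem_erase.mpr ⟨hne.symm, hr⟩),
            zero_mul]
          simp
      rw [eval_map_algebraMap, aeval_modByMonic_eq_self_of_root hr0, map_mul, hd, eval_finsetSum,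
        Finset.sum_eq_single_of_mem r hr]
      · simp [eval_prod, mul_comm]
      · intro r' _ hne
        rw [eval_mul, eval_prod, Finset.prod_eq_zero (Finset.mem_erase.mpr ⟨hne.symm, hr⟩),
          mul_zero]
        simp
  -- `c ^ (n - 1) ∏ (T - r') = ∏ (c T - c r')` has integral coefficients.
  let O := integralClosure A Ω
  have hcr (r : Ω) (hr : r ∈ s) : _root_.IsIntegral A (c • r) :=
    isIntegral_smul_root hp c hc ((hmem r).mp hr)
  have hBr (r : Ω) (hr : r ∈ s) : _root_.IsIntegral A (aeval r B) := by
    have := hB.map ((AdjoinRoot.liftAlgHom p (Algebra.ofId K Ω) r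
      (by rw [← (hmem r).mp hr]; rfl)).restrictScalars A)
    simpa [aeval_def] using this
  have hlift : C (algebraMap A Ω c ^ (p.natDegree - 1)) *
      ∑ r ∈ s, C (aeval r B) * ∏ r' ∈ s.erase r, (X - C r') ∈ liftsRing (algebraMap O Ω) := by
    rw [Finset.mul_sum]
    refine sum_mem fun r hr => ?_
    rw [mul_left_comm, ← hcard, ← Finset.card_erase_of_mem hr, C_pow, ← Finset.prod_const,
      ← Finset.prod_mul_distrib]
    refine mul_mem ?_ (prod_mem fun r' hr' => ?_)
    · rw [← lifts_iff_liftsRing]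
      exact C'_mem_lifts ⟨⟨_, hBr r hr⟩, rfl⟩
    · rw [mul_sub, ← C_mul, ← Algebra.smul_def]
      refine sub_mem (mul_mem ?_ ?_) ?_ <;> rw [← lifts_iff_liftsRing]
      · exact C'_mem_lifts ⟨algebraMap A O c, rfl⟩
      · exact X_mem_lifts _
      · exact C'_mem_lifts ⟨⟨_, hcr r' (Finset.mem_of_mem_erase hr')⟩, rfl⟩
  rw [← hinterp, ← lifts_iff_liftsRing, lifts_iff_coeff_lifts] at hlift
  obtain ⟨y, hy⟩ := hlift i
  rw [coeff_C_mul, coeff_map, IsScalarTower.algebraMap_apply A K Ω, ← map_pow, ← map_mul] at hy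
  have hint : _root_.IsIntegral A (algebraMap K Ω (algebraMap A K c ^ (p.natDegree - 1) *
      ((derivative p * B) %ₘ p).coeff i)) := hy ▸ y.2
  exact IsIntegrallyClosedIn.isIntegral_iff.mp
    ((isIntegral_algebraMap_iff (algebraMap K Ω).injective).mp hint)

/-- Coordinates of integral elements with respect to `1, t, …, t ^ (n - 1)` have bounded
denominators: since `v p' = 1` in `K[T]/(p)`, they can be computed from those of `p' b`. -/
theorem pow_mul_coeff_modByMonic_mem_range {A K : Type*} [CommRing A] [Field K]
    [Algebra A K] [IsIntegrallyClosedIn A K] {p u v : K[X]} (hp : p.Monic)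
    (huv : u * p + v * derivative p = 1) (c : A)
    (hc : ∀ i, algebraMap A K c * p.coeff i ∈ (algebraMap A K).range)
    (hcv : ∀ i, ∀ j < p.natDegree,
      algebraMap A K c * ((v * X ^ j) %ₘ p).coeff i ∈ (algebraMap A K).range) {B : K[X]}
    (hB : _root_.IsIntegral A (AdjoinRoot.mk p B)) (i : ℕ) :
    algebraMap A K (c ^ (p.natDegree - 1) * c) * (B %ₘ p).coeff i ∈ (algebraMap A K).range := by
  rcases eq_or_ne p 1 with rfl | hp1
  · exact ⟨0, by simp⟩
  have hG := pow_mul_coeff_derivative_mul_modByMonic_mem_range hp ⟨u, v, huv⟩ c hc hB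
  set G := (derivative p * B) %ₘ p with hGdef
  have hBG : B %ₘ p = (v * G) %ₘ p := by
    have h1 : v * G = B - p * (u * B + v * (derivative p * B /ₘ p)) := by
      rw [hGdef, modByMonic_eq_sub_mul_div]
      linear_combination B * huv
    rw [h1, sub_modByMonic, (modByMonic_eq_zero_iff_dvd hp).mpr (dvd_mul_right _ _), sub_zero]
  have hsum : G = ∑ j ∈ Finset.range p.natDegree, G.coeff j • X ^ j := by
    conv_lhs => rw [G.as_sum_range' p.natDegree (natDegree_modByMonic_lt _ hp hp1)]
    simp [← C_mul_X_pow_eq_monomial, smul_eq_C_mul]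
  have hcoeff : (B %ₘ p).coeff i =
      ∑ j ∈ Finset.range p.natDegree, G.coeff j * ((v * X ^ j) %ₘ p).coeff i := by
    rw [hBG]
    conv_lhs => rw [hsum]
    rw [Finset.mul_sum, ← modByMonicHom_apply, map_sum, finsetSum_coeff]
    simp [modByMonicHom]
  rw [hcoeff, Finset.mul_sum]
  refine sum_mem fun j hj => ?_
  rw [map_mul, map_pow, mul_mul_mul_comm]
  exact mul_mem (hG j) (hcv i j (Finset.mem_range.mp hj))

end Integrality

/-! ### Ideles with integral components -/

section Ideles

variable (X : Scheme.{u}) [IsNonsingularCurve X]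

/-- The ideles all of whose components are integral. They index the neighbourhood basis
`{c 𝔸_X⁺}` of `0` in `𝔸_X`, and serve as denominators of adeles. -/
noncomputable def integralIdeles : Submonoid (Adele X) :=
  IsUnit.submonoid (Adele X) ⊓ (integralAdele X).toSubmonoid

variable {X}

theorem isUnit_of_mem_integralIdeles {c : Adele X} (hc : c ∈ integralIdeles X) : IsUnit c := hc.1

theorem mem_integralAdele_of_mem_integralIdeles {c : Adele X} (hc : c ∈ integralIdeles X) :
    c ∈ integralAdele X := hc.2

theorem exists_mem_integralIdeles_apply (e : ∀ x, LocalField X x) (h0 : ∀ x, e x ≠ 0)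
    (hint : ∀ x, e x ∈ localIntegers X x)
    (h1 : ∀ᶠ x in Filter.cofinite, (e x)⁻¹ ∈ localIntegers X x) :
    ∃ c ∈ integralIdeles X, ∀ x, c x = e x := by
  let c : Adele X := ⟨e, Filter.Eventually.of_forall hint⟩
  let d : Adele X := ⟨fun x => (e x)⁻¹, h1⟩
  have hcd : c * d = 1 := RestrictedProduct.ext _ _ fun x => mul_inv_cancel₀ (h0 x)
  exact ⟨c, ⟨IsUnit.of_mul_eq_one d hcd, (mem_integralAdele X).mpr hint⟩, fun _ => rfl⟩

theorem apply_ne_zero_of_mem_integralIdeles {c : Adele X} (hc : c ∈ integralIdeles X)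
    (x : ClosedPoint X) : c x ≠ 0 :=
  ((isUnit_of_mem_integralIdeles hc).map (Adele.eval X x)).ne_zero

theorem eventually_inv_apply_mem_of_mem_integralIdeles {c : Adele X} (hc : c ∈ integralIdeles X) :
    ∀ᶠ x in Filter.cofinite, (c x)⁻¹ ∈ localIntegers X x := by
  obtain ⟨d, hd⟩ := (isUnit_of_mem_integralIdeles hc).exists_right_inv
  filter_upwards [d.2] with x hx
  have h : c x * d x = 1 := congrArg (Adele.eval X x) hd
  rw [inv_eq_of_mul_eq_one_right h]
  exact hx

/-- The denominator is `a x` inverted at the places where `a` is not integral. -/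
theorem exists_integralIdele_mul_mem (a : Adele X) :
    ∃ c ∈ integralIdeles X, c * a ∈ integralAdele X := by
  classical
  obtain ⟨c, hc, hce⟩ := exists_mem_integralIdeles_apply
    (fun x => if a x ∈ localIntegers X x then 1 else (a x)⁻¹)
    (fun x => by
      split_ifs with h
      · exact one_ne_zero
      · exact inv_ne_zero fun h0 : a x = 0 => h (h0 ▸ zero_mem _))
    (fun x => by
      split_ifs with h
      · exact one_mem _
      · exact ((localIntegers X x).mem_or_inv_mem (a x)).resolve_left h)
    (by
      filter_upwards [a.2] with x hx
      rw [if_pos (show a x ∈ localIntegers X x from hx), inv_one]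
      exact one_mem _)
  refine ⟨c, hc, (mem_integralAdele X).mpr fun x => ?_⟩
  change c x * a x ∈ _
  rw [hce]
  split_ifs with h
  · rwa [one_mul]
  · rw [inv_mul_cancel₀ fun h0 : a x = 0 => h (h0 ▸ zero_mem _)]
    exact one_mem _

theorem exists_integralIdele_forall_mul_mem {ι : Type*} (s : Finset ι) (a : ι → Adele X) :
    ∃ c ∈ integralIdeles X, ∀ i ∈ s, c * a i ∈ integralAdele X := by
  choose c hc hca using fun i => exists_integralIdele_mul_mem (a i)
  refine ⟨∏ i ∈ s, c i, prod_mem fun i _ => hc i, fun i hi => ?_⟩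
  classical
  rw [← Finset.mul_prod_erase s c hi, mul_right_comm]
  exact mul_mem (hca i) (prod_mem fun j _ => mem_integralAdele_of_mem_integralIdeles (hc j))

end Ideles

/-! ### Coordinates on `𝔸_X{p}` and the integral closure -/

section Coordinates

open Polynomial

/-- The coordinates of the elements of `R[T]/(p)` with respect to `1, T, …, T ^ (n - 1)`. -/
noncomputable def coordEquiv {R : Type*} [CommRing R] {p : R[X]} (hp : p.Monic) :
    AdjoinRoot p ≃ₗ[R] (Fin p.natDegree → R) :=
  (AdjoinRoot.powerBasisAux' hp).equivFun

theorem coordEquiv_mk {R : Type*} [CommRing R] {p : R[X]} (hp : p.Monic) (Q : R[X])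
    (i : Fin p.natDegree) : coordEquiv hp (AdjoinRoot.mk p Q) i = (Q %ₘ p).coeff i := by
  rfl

theorem sum_coordEquiv_smul_root_pow {R : Type*} [CommRing R] {p : R[X]} (hp : p.Monic)
    (α : AdjoinRoot p) : ∑ i, coordEquiv hp α i • AdjoinRoot.root p ^ (i : ℕ) = α := by
  have h := (AdjoinRoot.powerBasis' hp).basis.sum_equivFun α
  simp only [PowerBasis.coe_basis] at h
  exact h

variable {X : Scheme.{u}} [IsNonsingularCurve X] {p : (Adele X)[X]}

theorem toLocal_mk (x : ClosedPoint X) (Q : (Adele X)[X]) :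
    toLocal p x (AdjoinRoot.mk p Q) = AdjoinRoot.mk (localPoly p x) (Q.map (Adele.eval X x)) := by
  induction Q using Polynomial.induction_on' with
  | add P Q hP hQ => simp [hP, hQ]
  | monomial n a =>
    rw [← C_mul_X_pow_eq_monomial]
    simp [toLocal]

theorem toLocal_of (x : ClosedPoint X) (a : Adele X) :
    toLocal p x (AdjoinRoot.of p a) = AdjoinRoot.of (localPoly p x) (a x) := by
  simp [toLocal]

theorem toLocal_smul (x : ClosedPoint X) (a : Adele X) (α : AdjoinRoot p) :
    toLocal p x (a • α) = a x • toLocal p x α := by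
  rw [Algebra.smul_def, map_mul, Algebra.smul_def]
  congr 1
  exact toLocal_of x a

theorem natDegree_localPoly (hp : p.Monic) (x : ClosedPoint X) :
    (localPoly p x).natDegree = p.natDegree :=
  hp.natDegree_map _

theorem coeff_modByMonic_localPoly (hp : p.Monic) (x : ClosedPoint X) (Q : (Adele X)[X]) (i : ℕ) :
    (Q.map (Adele.eval X x) %ₘ localPoly p x).coeff i = (Q %ₘ p).coeff i x := by
  rw [localPoly, ← map_modByMonic _ hp, coeff_map]
  rfl

theorem toLocal_mem_localClosure (x : ClosedPoint X) {α : AdjoinRoot p}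
    (hα : α ∈ integralClosure (integralAdele X) (AdjoinRoot p)) :
    toLocal p x α ∈ localClosure p x := by
  let f : integralAdele X →+* localIntegers X x :=
    ((Adele.eval X x).comp (integralAdele X).subtype).codRestrict (localIntegers X x)
      fun a => (mem_integralAdele X).mp a.2 x
  refine IsIntegral.map_of_comp_eq f (toLocal p x) (RingHom.ext fun a => ?_) hα
  exact (toLocal_of x (a : Adele X)).symm

/-- An element whose coordinates lie in `A` becomes integral over `A` after multiplication by a
power of a common denominator `c` of the coefficients of `p`, because `c t` is integral. -/
theorem smul_mem_integralClosure_of_coordEquiv_mem {R : Type*} [CommRing R] (A : Subring R)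
    {p : R[X]} (hp : p.Monic) {c : R} (hcA : c ∈ A) (hc : ∀ i, c * p.coeff i ∈ A)
    {α : AdjoinRoot p} (hα : ∀ i, coordEquiv hp α i ∈ A) :
    (c ^ (p.natDegree - 1) * c) • α ∈ integralClosure A (AdjoinRoot p) := by
  let C : A := ⟨c, hcA⟩
  have hroot : C • AdjoinRoot.root p ∈ integralClosure A (AdjoinRoot p) :=
    isIntegral_smul_root hp C (fun i => ⟨⟨_, hc i⟩, rfl⟩)
      (by rw [AdjoinRoot.aeval_eq, AdjoinRoot.mk_self])
  rw [← sum_coordEquiv_smul_root_pow hp α, Finset.smul_sum]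
  refine sum_mem fun i _ => ?_
  have h1 : (c ^ (p.natDegree - 1) * c) • coordEquiv hp α i • AdjoinRoot.root p ^ (i : ℕ) =
      (C ^ (p.natDegree - i) * ⟨_, hα i⟩ : A) • (C • AdjoinRoot.root p) ^ (i : ℕ) := by
    have h2 : c ^ (p.natDegree - 1) * c = c ^ (p.natDegree - i) * c ^ (i : ℕ) := by
      rw [← pow_succ, ← pow_add]
      congr 1
      omega
    rw [h2, _root_.smul_pow, smul_smul, smul_smul]
    exact congrArg (· • AdjoinRoot.root p ^ (i : ℕ)) (mul_right_comm _ _ _)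
  rw [h1]
  exact Subalgebra.smul_mem _ (pow_mem hroot _) _

theorem coordEquiv_toLocal (hp : p.Monic) (x : ClosedPoint X) (α : AdjoinRoot p)
    (i : Fin p.natDegree) :
    coordEquiv (hp.map (Adele.eval X x)) (toLocal p x α)
      (Fin.cast (natDegree_localPoly hp x).symm i) = coordEquiv hp α i x := by
  obtain ⟨Q, rfl⟩ := AdjoinRoot.mk_surjective α
  rw [toLocal_mk]
  exact coeff_modByMonic_localPoly hp x Q i

/-- The bound `pow_mul_coeff_modByMonic_mem_range` at the place `x`, with a denominator that is
independent of `x`. -/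
theorem mul_coordEquiv_mem_localIntegers (hp : p.Monic) {u v : (Adele X)[X]}
    (huv : u * p + v * derivative p = 1) {c : Adele X} (hc : c ∈ integralAdele X)
    (hcp : ∀ i, c * p.coeff i ∈ integralAdele X)
    (hcv : ∀ i, ∀ j < p.natDegree, c * ((v * Polynomial.X ^ j) %ₘ p).coeff i ∈ integralAdele X)
    {x : ClosedPoint X} {β : AdjoinRoot (localPoly p x)} (hβ : β ∈ localClosure p x)
    (i : Fin (localPoly p x).natDegree) :
    (c ^ (p.natDegree - 1) * c) x * coordEquiv (hp.map (Adele.eval X x)) β i ∈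
      localIntegers X x := by
  obtain ⟨B, rfl⟩ := AdjoinRoot.mk_surjective β
  have hv (i j : ℕ) : ((v.map (Adele.eval X x) * Polynomial.X ^ j) %ₘ localPoly p x).coeff i =
      ((v * Polynomial.X ^ j) %ₘ p).coeff i x := by
    rw [← coeff_modByMonic_localPoly hp, Polynomial.map_mul, Polynomial.map_pow, map_X]
  obtain ⟨y, hy⟩ := pow_mul_coeff_modByMonic_mem_range (hp.map (Adele.eval X x))
    (u := u.map (Adele.eval X x)) (v := v.map (Adele.eval X x))
    (by rw [derivative_map, ← Polynomial.map_mul, ← Polynomial.map_mul, ← Polynomial.map_add, huv,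
      Polynomial.map_one])
    (⟨c x, (mem_integralAdele X).mp hc x⟩ : localIntegers X x)
    (fun i => ⟨⟨_, (mem_integralAdele X).mp (hcp i) x⟩, by rw [coeff_map]; rfl⟩)
    (fun i j hj => ⟨⟨_, (mem_integralAdele X).mp (hcv i j (natDegree_localPoly hp x ▸ hj)) x⟩, by
      rw [hv]; rfl⟩) hβ i
  have hpow : (Polynomial.map (Adele.eval X x) p).natDegree - 1 = p.natDegree - 1 := by
    rw [natDegree_localPoly hp]
  rw [hpow] at hy
  exact Set.mem_of_eq_of_mem hy.symm y.2

/-- The integral closure of `𝔸_X⁺` and the free `𝔸_X⁺`-module on `1, t, …, t ^ (n - 1)` contain each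
other up to an idele. The upper bound is stated at every place, since it is also needed for the
`𝔅_x`. -/
theorem exists_integralIdele_bounds (hp : p.Monic) (hsep : p.Separable) :
    ∃ c ∈ integralIdeles X,
      (∀ α : AdjoinRoot p, (∀ i, coordEquiv hp α i ∈ integralAdele X) →
        c • α ∈ integralClosure (integralAdele X) (AdjoinRoot p)) ∧
      (∀ (x : ClosedPoint X), ∀ β ∈ localClosure p x, ∀ i,
        c x * coordEquiv (hp.map (Adele.eval X x)) β i ∈ localIntegers X x) := by
  obtain ⟨u, v, huv⟩ := hsep
  obtain ⟨c₁, hc₁, hcp⟩ := exists_integralIdele_forall_mul_mem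
    (Finset.range (p.natDegree + 1)) p.coeff
  obtain ⟨c₂, hc₂, hcv⟩ := exists_integralIdele_forall_mul_mem
    (Finset.range p.natDegree ×ˢ Finset.range p.natDegree)
    fun ij => ((v * Polynomial.X ^ ij.2) %ₘ p).coeff ij.1
  have hcp' (i : ℕ) : c₁ * c₂ * p.coeff i ∈ integralAdele X := by
    rw [mul_right_comm]
    refine mul_mem ?_ (mem_integralAdele_of_mem_integralIdeles hc₂)
    rcases lt_or_ge p.natDegree i with h | h
    · rw [coeff_eq_zero_of_natDegree_lt h, mul_zero]
      exact zero_mem _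
    · exact hcp i (Finset.mem_range.mpr (by omega))
  have hcv' (i j : ℕ) (hj : j < p.natDegree) :
      c₁ * c₂ * ((v * Polynomial.X ^ j) %ₘ p).coeff i ∈ integralAdele X := by
    rw [mul_assoc]
    refine mul_mem (mem_integralAdele_of_mem_integralIdeles hc₁) ?_
    rcases lt_or_ge i p.natDegree with h | h
    · exact hcv (i, j) (by simp [h, hj])
    · nontriviality (Adele X)
      rw [coeff_eq_zero_of_degree_lt ((degree_modByMonic_lt _ hp).trans_le
        (degree_le_of_natDegree_le h)), mul_zero]
      exact zero_mem _
  have hc := mul_mem hc₁ hc₂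
  have hcint := mem_integralAdele_of_mem_integralIdeles hc
  set c := c₁ * c₂
  exact ⟨c ^ (p.natDegree - 1) * c, mul_mem (pow_mem hc _) hc,
    fun α hα => smul_mem_integralClosure_of_coordEquiv_mem _ hp hcint hcp' hα,
    fun x β hβ i => mul_coordEquiv_mem_localIntegers hp huv hcint hcp' hcv' hβ i⟩

end Coordinates

/-! ### The subgroups `U_D` and the coordinates -/

section DivisorSubgroups

/-- A subalgebra whose elements have coordinates with a common denominator `c` embeds in a free
module of finite rank. -/
theorem Subalgebra.isNoetherian_of_forall_mul_mem_range {A K E ι : Type*} [CommRing A]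
    [IsNoetherianRing A] [Field K] [CommRing E] [Algebra A K] [Algebra K E] [Algebra A E]
    [IsScalarTower A K E] [Finite ι] (B : Subalgebra A E) (φ : E ≃ₗ[K] (ι → K)) {c : K}
    (hc0 : c ≠ 0) (hc : ∀ β ∈ B, ∀ i, c * φ β i ∈ (algebraMap A K).range) : IsNoetherian A B := by
  let g : (ι → A) →ₗ[A] (ι → K) := (Algebra.linearMap A K).compLeft ι
  have hg : IsNoetherian A (LinearMap.range g) :=
    isNoetherian_of_surjective (f := g.rangeRestrict) g.range_rangeRestrict
  let f : B →ₗ[A] (ι → K) :=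
    (c • φ.toLinearMap).restrictScalars A ∘ₗ B.val.toLinearMap
  have hf (β : B) : f β ∈ LinearMap.range g := by
    choose a ha using hc β β.2
    exact ⟨a, funext ha⟩
  refine isNoetherian_of_injective (f.codRestrict _ hf) fun β γ h => Subtype.ext (φ.injective ?_)
  exact smul_right_injective _ hc0 (congrArg Subtype.val h)

variable {X : Scheme.{u}} [IsNonsingularCurve X] {p : Polynomial (Adele X)}

theorem isNoetherian_localClosure (hp : p.Monic) (x : ClosedPoint X) {c : LocalField X x}
    (hc0 : c ≠ 0)
    (hc : ∀ β ∈ localClosure p x, ∀ i,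
      c * coordEquiv (hp.map (Adele.eval X x)) β i ∈ localIntegers X x) :
    IsNoetherian (localIntegers X x) (localClosure p x) :=
  (localClosure p x).isNoetherian_of_forall_mul_mem_range (coordEquiv (hp.map (Adele.eval X x))) hc0
    fun β hβ i => ⟨⟨_, hc β hβ i⟩, rfl⟩

/-- Since `𝔅_x` is Noetherian, a power of the radical `𝔫_x` of `𝔪_x 𝔅_x` lies in `e 𝔅_x`. -/
theorem exists_localIdeal_pow_le_span (x : ClosedPoint X)
    (h : IsNoetherian (localIntegers X x) (localClosure p x)) {e : localIntegers X x}
    (he : e ≠ 0) :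
    ∃ k, localIdeal p x ^ k ≤ Ideal.span {algebraMap _ (localClosure p x) e} := by
  have : IsNoetherianRing (localClosure p x) := isNoetherian_of_tower (localIntegers X x) h
  have hle : localIdeal p x ≤ (Ideal.span {algebraMap _ (localClosure p x) e}).radical := by
    refine Ideal.radical_le_radical_iff.mpr (Ideal.map_le_iff_le_comap.mpr ?_)
    obtain ⟨ϖ, hϖ⟩ := IsDiscreteValuationRing.exists_irreducible (localIntegers X x)
    obtain ⟨n, u, hu⟩ := IsDiscreteValuationRing.eq_unit_mul_pow_irreducible he hϖ
    rw [hϖ.maximalIdeal_eq, Ideal.span_singleton_le_iff_mem, Ideal.mem_comap]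
    refine ⟨n, ?_⟩
    rw [← map_pow, Ideal.mem_span_singleton]
    exact map_dvd _ ⟨(u⁻¹ : (localIntegers X x)ˣ), by
      rw [hu, mul_right_comm, Units.mul_inv, one_mul]⟩
  obtain ⟨k, hk⟩ := Ideal.exists_radical_pow_le_of_fg
    (Ideal.span {algebraMap _ (localClosure p x) e}) (IsNoetherian.noetherian _)
  exact ⟨k, (Ideal.pow_right_mono hle k).trans hk⟩

theorem coe_algebraMap_mul (x : ClosedPoint X) (a : localIntegers X x) (b : localClosure p x) :
    ((algebraMap (localIntegers X x) (localClosure p x) a * b : localClosure p x) :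
      AdjoinRoot (localPoly p x)) = (a : LocalField X x) • (b : AdjoinRoot (localPoly p x)) := by
  rw [Algebra.smul_def]
  rfl

theorem mem_divisorSubgroup {D : ClosedPoint X →₀ ℕ} {α : AdjoinRoot p} :
    α ∈ divisorSubgroup p D ↔
      ∀ x, ∃ b ∈ localIdeal p x ^ D x, (b : AdjoinRoot (localPoly p x)) = toLocal p x α := by
  simp only [divisorSubgroup, AddSubgroup.mem_iInf]
  rfl

theorem exists_mul_eq_of_mul_inv_mem {c : Adele X} (hc : IsUnit c) {a : Adele X}
    (h : ∀ x, (c x)⁻¹ * a x ∈ localIntegers X x) : ∃ b ∈ integralAdele X, c * b = a := by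
  obtain ⟨d, hd⟩ := hc.exists_right_inv
  refine ⟨d * a, (mem_integralAdele X).mpr fun x => ?_, by rw [← mul_assoc, hd, one_mul]⟩
  have h1 : c x * d x = 1 := congrArg (Adele.eval X x) hd
  change d x * a x ∈ _
  rw [← inv_eq_of_mul_eq_one_right h1]
  exact h x

/-- At almost all places `c` and the denominator `c₀` of the coordinates of integral elements are
units, and there the coefficient of `D` may be taken to be `0`. -/
theorem exists_divisorSubgroup_le (hp : p.Monic) (hsep : p.Separable) {c : Adele X}
    (hc : c ∈ integralIdeles X) : ∃ D : ClosedPoint X →₀ ℕ, ∀ α ∈ divisorSubgroup p D, ∀ i,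
      ∃ b ∈ integralAdele X, c * b = coordEquiv hp α i := by
  classical
  obtain ⟨c₀, hc₀, -, hbound⟩ := exists_integralIdele_bounds hp hsep
  have hcc := mul_mem hc hc₀
  have hpow (x : ClosedPoint X) := exists_localIdeal_pow_le_span x
    (isNoetherian_localClosure hp x (apply_ne_zero_of_mem_integralIdeles hc₀ x) (hbound x))
    (e := ⟨_, (mem_integralAdele X).mp (mem_integralAdele_of_mem_integralIdeles hcc) x⟩)
    (fun h => apply_ne_zero_of_mem_integralIdeles hcc x (congrArg Subtype.val h))
  choose k hk using hpow
  have hfin := eventually_inv_apply_mem_of_mem_integralIdeles hcc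
  rw [Filter.eventually_cofinite] at hfin
  refine ⟨Finsupp.onFinset hfin.toFinset
    (fun x => if ((c * c₀) x)⁻¹ ∈ localIntegers X x then 0 else k x) fun x hx => by
      simpa using fun h => hx (if_pos h), fun α hα i => ?_⟩
  refine exists_mul_eq_of_mul_inv_mem (isUnit_of_mem_integralIdeles hc) fun x => ?_
  have hc₀x := apply_ne_zero_of_mem_integralIdeles hc₀ x
  have hcx := apply_ne_zero_of_mem_integralIdeles hc x
  have hmul : (c * c₀) x = c x * c₀ x := rfl
  obtain ⟨b, hb, hbα⟩ := mem_divisorSubgroup.mp hα x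
  rw [← coordEquiv_toLocal hp, ← hbα]
  set j := Fin.cast (natDegree_localPoly hp x).symm i
  by_cases hx : ((c * c₀) x)⁻¹ ∈ localIntegers X x
  · have := mul_mem hx (hbound x b b.2 j)
    rw [hmul] at this
    convert this using 1
    field_simp
  · rw [Finsupp.onFinset_apply, if_neg hx] at hb
    obtain ⟨b', rfl⟩ := Ideal.mem_span_singleton.mp (hk x hb)
    rw [coe_algebraMap_mul, map_smul, Pi.smul_apply, smul_eq_mul]
    dsimp only
    rw [hmul, mul_assoc, inv_mul_cancel_left₀ hcx]
    exact hbound x b' b'.2 j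

/-- Up to the idele that makes elements with integral coordinates integral, `c` is the product of
the powers of local uniformizers prescribed by `D`. -/
theorem exists_smul_mem_divisorSubgroup (hp : p.Monic) (hsep : p.Separable)
    (D : ClosedPoint X →₀ ℕ) : ∃ c ∈ integralIdeles X, ∀ α : AdjoinRoot p,
      (∀ i, coordEquiv hp α i ∈ integralAdele X) → c • α ∈ divisorSubgroup p D := by
  obtain ⟨c₀, hc₀, hbound, -⟩ := exists_integralIdele_bounds hp hsep
  have hϖ (x : ClosedPoint X) := IsDiscreteValuationRing.exists_irreducible (localIntegers X x)
  choose ϖ hϖ using hϖ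
  obtain ⟨e, he, hex⟩ := exists_mem_integralIdeles_apply
    (fun x => (ϖ x : LocalField X x) ^ D x)
    (fun x => pow_ne_zero _ fun h => (hϖ x).ne_zero (Subtype.ext h))
    (fun x => pow_mem (ϖ x).2 _)
    (by
      filter_upwards [D.hasFiniteSupport.compl_mem_cofinite] with x hx
      rw [Function.notMem_support.mp hx, pow_zero, inv_one]
      exact one_mem _)
  refine ⟨e * c₀, mul_mem he hc₀, fun α hα => mem_divisorSubgroup.mpr fun x => ?_⟩
  let b : localClosure p x := ⟨_, toLocal_mem_localClosure x (hbound α hα)⟩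
  refine ⟨algebraMap (localIntegers X x) _ (ϖ x) ^ D x * b, Ideal.mul_mem_right _ _
    (Ideal.pow_mem_pow (Ideal.le_radical (Ideal.mem_map_of_mem _ ?_)) _), ?_⟩
  · exact (IsLocalRing.mem_maximalIdeal _).mpr (hϖ x).not_isUnit
  · rw [mul_smul, toLocal_smul, hex, ← map_pow, coe_algebraMap_mul]
    rfl

end DivisorSubgroups

/-! ### Commensurability -/

section AlmostLE

variable {k M N : Type*} [Field k] [AddCommGroup M] [Module k M] [AddCommGroup N] [Module k N]

/-- `U` is contained in `V` up to a finite-dimensional space. -/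
def AlmostLE (U V : Submodule k M) : Prop :=
  ∃ F : Submodule k M, F.FG ∧ U ≤ V ⊔ F

namespace AlmostLE

variable {U V W : Submodule k M}

theorem of_le (h : U ≤ V) : AlmostLE U V := ⟨⊥, Submodule.fg_bot, by simpa⟩

theorem trans (h : AlmostLE U V) (h' : AlmostLE V W) : AlmostLE U W := by
  obtain ⟨F, hF, hUV⟩ := h
  obtain ⟨G, hG, hVW⟩ := h'
  refine ⟨G ⊔ F, hG.sup hF, hUV.trans ?_⟩
  rw [← sup_assoc]
  exact sup_le_sup_right hVW F

theorem sup (h : AlmostLE U W) (h' : AlmostLE V W) : AlmostLE (U ⊔ V) W := by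
  obtain ⟨F, hF, hU⟩ := h
  obtain ⟨G, hG, hV⟩ := h'
  refine ⟨F ⊔ G, hF.sup hG, sup_le (hU.trans ?_) (hV.trans ?_)⟩
  · exact sup_le_sup_left le_sup_left W
  · exact sup_le_sup_left le_sup_right W

theorem map (h : AlmostLE U V) (f : M →ₗ[k] N) : AlmostLE (U.map f) (V.map f) := by
  obtain ⟨F, hF, hU⟩ := h
  exact ⟨F.map f, hF.map f, (Submodule.map_mono hU).trans (Submodule.map_sup _ _ _).le⟩

theorem ker_iff (g : M →ₗ[k] N) :
    AlmostLE U (LinearMap.ker g) ↔ FiniteDimensional k (U.map g) := by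
  constructor
  · rintro ⟨F, hF, hU⟩
    have hFg : FiniteDimensional k (F.map g) := Module.Finite.iff_fg.mpr (hF.map _)
    refine Submodule.finiteDimensional_of_le (S₂ := F.map g) ((Submodule.map_mono hU).trans ?_)
    rw [Submodule.map_sup, LinearMap.le_ker_iff_map.mp (le_refl (LinearMap.ker g)), bot_sup_eq]
  · intro h
    obtain ⟨s, hs⟩ := (g.submoduleMap U).exists_rightInverse_of_surjective
      (LinearMap.range_eq_top.mpr (g.submoduleMap_surjective U))
    refine ⟨LinearMap.range (U.subtype ∘ₗ s), Module.Finite.iff_fg.mp inferInstance,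
      fun u hu => ?_⟩
    let y : U.map g := ⟨g u, Submodule.mem_map_of_mem hu⟩
    refine Submodule.mem_sup.mpr ⟨u - s y, ?_, s y, ⟨y, rfl⟩, sub_add_cancel _ _⟩
    rw [LinearMap.mem_ker, map_sub, sub_eq_zero]
    exact (congrArg Subtype.val (LinearMap.congr_fun hs y)).symm

theorem iff_finiteDimensional_map_mkQ : AlmostLE U V ↔ FiniteDimensional k (U.map V.mkQ) := by
  rw [← ker_iff, Submodule.ker_mkQ]

theorem inf (h : AlmostLE U V) (h' : AlmostLE U W) : AlmostLE U (V ⊓ W) := by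
  rw [iff_finiteDimensional_map_mkQ] at h h'
  have hker : V ⊓ W = LinearMap.ker (V.mkQ.prod W.mkQ) := by
    rw [LinearMap.ker_prod, Submodule.ker_mkQ, Submodule.ker_mkQ]
  rw [hker, ker_iff]
  have hfin : FiniteDimensional k ((U.map V.mkQ).prod (U.map W.mkQ)) :=
    Module.Finite.iff_fg.mpr
      ((Module.Finite.iff_fg.mp h).prod (Module.Finite.iff_fg.mp h'))
  refine Submodule.finiteDimensional_of_le (S₂ := (U.map V.mkQ).prod (U.map W.mkQ)) ?_
  rintro _ ⟨u, hu, rfl⟩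
  exact ⟨Submodule.mem_map_of_mem hu, Submodule.mem_map_of_mem hu⟩

theorem comap (f : M →ₗ[k] N) {U V : Submodule k N} (h : AlmostLE U V) :
    AlmostLE (U.comap f) (V.comap f) := by
  rw [iff_finiteDimensional_map_mkQ] at h
  have hker : V.comap f = LinearMap.ker (V.mkQ ∘ₗ f) := by
    rw [LinearMap.ker_comp, Submodule.ker_mkQ]
  rw [hker, ker_iff]
  refine Submodule.finiteDimensional_of_le (S₂ := U.map V.mkQ) ?_
  rw [Submodule.map_comp]
  exact Submodule.map_mono (Submodule.map_comap_le _ _)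

theorem pi {ι : Type*} [Finite ι] {U V : ι → Submodule k M} (h : ∀ i, AlmostLE (U i) (V i)) :
    AlmostLE (Submodule.pi Set.univ U) (Submodule.pi Set.univ V) := by
  choose F hF hU using h
  refine ⟨Submodule.pi Set.univ F, Submodule.fg_pi hF, fun a ha => ?_⟩
  have hdec (i : ι) := Submodule.mem_sup.mp (hU i (ha i trivial))
  choose v hv f hf hvf using hdec
  exact Submodule.mem_sup.mpr ⟨v, fun i _ => hv i, f, fun i _ => hf i, funext hvf⟩

end AlmostLE

variable {U V W : Submodule k M}

theorem isCommensurable_iff_almostLE : IsCommensurable U V ↔ AlmostLE U V ∧ AlmostLE V U := by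
  have h : IsCommensurable U V ↔ AlmostLE (U ⊔ V) (U ⊓ V) := by
    have e := ((U ⊓ V).mkQ ∘ₗ (U ⊔ V).subtype).quotKerEquivRange
    rw [LinearMap.ker_comp, Submodule.ker_mkQ, LinearMap.range_comp, Submodule.range_subtype] at e
    rw [AlmostLE.iff_finiteDimensional_map_mkQ]
    exact ⟨fun h => Module.Finite.of_surjective (hM := h) e.toLinearMap e.surjective,
      fun h => e.symm.finiteDimensional⟩
  rw [h]
  refine ⟨fun h => ⟨?_, ?_⟩, fun ⟨h₁, h₂⟩ =>
    .sup (.inf (.of_le le_rfl) h₁) (.inf h₂ (.of_le le_rfl))⟩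
  · exact (AlmostLE.of_le le_sup_left).trans (h.trans (.of_le inf_le_right))
  · exact (AlmostLE.of_le le_sup_right).trans (h.trans (.of_le inf_le_left))

namespace IsCommensurable

theorem refl (U : Submodule k M) : IsCommensurable U U :=
  isCommensurable_iff_almostLE.mpr ⟨.of_le le_rfl, .of_le le_rfl⟩

theorem symm (h : IsCommensurable U V) : IsCommensurable V U := by
  rw [isCommensurable_iff_almostLE] at *
  exact h.symm

theorem trans (h : IsCommensurable U V) (h' : IsCommensurable V W) : IsCommensurable U W := by
  rw [isCommensurable_iff_almostLE] at *
  exact ⟨h.1.trans h'.1, h'.2.trans h.2⟩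

theorem inf (h : IsCommensurable U W) (h' : IsCommensurable V W) : IsCommensurable (U ⊓ V) W := by
  rw [isCommensurable_iff_almostLE] at *
  exact ⟨(AlmostLE.of_le inf_le_left).trans h.1, h.2.inf h'.2⟩

theorem comap (f : M →ₗ[k] N) {U V : Submodule k N} (h : IsCommensurable U V) :
    IsCommensurable (U.comap f) (V.comap f) := by
  rw [isCommensurable_iff_almostLE] at *
  exact ⟨h.1.comap f, h.2.comap f⟩

theorem pi {ι : Type*} [Finite ι] {U V : ι → Submodule k M} (h : ∀ i, IsCommensurable (U i) (V i)) :
    IsCommensurable (Submodule.pi Set.univ U) (Submodule.pi Set.univ V) := by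
  simp only [isCommensurable_iff_almostLE] at *
  exact ⟨.pi fun i => (h i).1, .pi fun i => (h i).2⟩

/-- A subspace commensurable with `V ^ ι` contains a product of subspaces commensurable with `V`,
namely of its intersections with the coordinate axes. -/
theorem exists_pi_le {ι : Type*} [Finite ι] {U : Submodule k (ι → M)}
    (h : IsCommensurable U (Submodule.pi Set.univ fun _ => V)) :
    ∃ W : ι → Submodule k M, (∀ i, IsCommensurable (W i) V) ∧ Submodule.pi Set.univ W ≤ U := by
  classical
  have := Fintype.ofFinite ι
  refine ⟨fun i => V ⊓ U.comap (LinearMap.single k (fun _ => M) i), fun i => ?_, fun a ha => ?_⟩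
  · rw [isCommensurable_iff_almostLE] at *
    refine ⟨.of_le inf_le_left, .inf (.of_le le_rfl) ?_⟩
    refine (AlmostLE.of_le fun v hv => ?_).trans (h.2.comap (LinearMap.single k (fun _ => M) i))
    rw [Submodule.mem_comap, Submodule.mem_pi]
    intro j _
    rw [LinearMap.single_apply, Pi.single_apply]
    split_ifs
    · exact hv
    · exact zero_mem V
  · rw [← LinearMap.sum_single_apply (fun _ => M) a]
    exact sum_mem fun i _ => (ha i trivial).2

end IsCommensurable

end AlmostLE

/-! ### Topologies given by subgroups -/

section TopologyOfSubgroups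

variable {G : Type*} [AddCommGroup G] {𝓑 : Set (AddSubgroup G)}

theorem isTopologicalBasis_topologyOfSubgroups (hne : 𝓑.Nonempty)
    (hdir : ∀ U ∈ 𝓑, ∀ V ∈ 𝓑, ∃ W ∈ 𝓑, W ≤ U ⊓ V) :
    @TopologicalSpace.IsTopologicalBasis G (topologyOfSubgroups 𝓑)
      {s | ∃ U ∈ 𝓑, ∃ a : G, s = {g | g - a ∈ U}} := by
  let τ := topologyOfSubgroups 𝓑
  refine ⟨?_, ?_, rfl⟩
  · rintro _ ⟨U, hU, a, rfl⟩ _ ⟨V, hV, b, rfl⟩ g ⟨hgU, hgV⟩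
    obtain ⟨W, hW, hWUV⟩ := hdir U hU V hV
    refine ⟨_, ⟨W, hW, g, rfl⟩, by simp, fun y hy => ⟨?_, ?_⟩⟩
    · simpa using U.add_mem (hWUV hy).1 hgU
    · simpa using V.add_mem (hWUV hy).2 hgV
  · obtain ⟨U, hU⟩ := hne
    refine Set.eq_univ_of_forall fun g => ⟨_, ⟨U, hU, g, rfl⟩, ?_⟩
    simp

theorem hasBasis_nhds_topologyOfSubgroups (hne : 𝓑.Nonempty)
    (hdir : ∀ U ∈ 𝓑, ∀ V ∈ 𝓑, ∃ W ∈ 𝓑, W ≤ U ⊓ V) (a : G) :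
    (@nhds G (topologyOfSubgroups 𝓑) a).HasBasis (· ∈ 𝓑) fun U => {g | g - a ∈ U} := by
  let τ := topologyOfSubgroups 𝓑
  refine ⟨fun t => ?_⟩
  rw [(isTopologicalBasis_topologyOfSubgroups hne hdir).mem_nhds_iff]
  constructor
  · rintro ⟨_, ⟨U, hU, b, rfl⟩, hab, hst⟩
    refine ⟨U, hU, fun g hg => hst ?_⟩
    simpa using U.add_mem hg hab
  · rintro ⟨U, hU, hUt⟩
    exact ⟨_, ⟨U, hU, a, rfl⟩, by simp, hUt⟩

theorem isTopologicalAddGroup_topologyOfSubgroups (hne : 𝓑.Nonempty)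
    (hdir : ∀ U ∈ 𝓑, ∀ V ∈ 𝓑, ∃ W ∈ 𝓑, W ≤ U ⊓ V) :
    @IsTopologicalAddGroup G (topologyOfSubgroups 𝓑) _ := by
  let τ := topologyOfSubgroups 𝓑
  have hb := hasBasis_nhds_topologyOfSubgroups hne hdir
  refine { continuous_add := ?_, continuous_neg := ?_ }
  · rw [continuous_iff_continuousAt]
    rintro ⟨a, b⟩
    rw [ContinuousAt, nhds_prod_eq]
    refine (((hb a).prod (hb b)).tendsto_iff (hb _)).mpr fun U hU =>
      ⟨(U, U), ⟨hU, hU⟩, fun g hg => ?_⟩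
    have h : g.1 + g.2 - (a + b) = g.1 - a + (g.2 - b) := by abel
    exact SetLike.mem_coe.mp (Set.mem_of_eq_of_mem h (U.add_mem hg.1 hg.2))
  · rw [continuous_iff_continuousAt]
    intro a
    refine ((hb a).tendsto_iff (hb _)).mpr fun U hU => ⟨U, hU, fun g hg => ?_⟩
    have h : -g - -a = -(g - a) := by abel
    exact SetLike.mem_coe.mp (Set.mem_of_eq_of_mem h (U.neg_mem hg))

/-- In a linearly topologized space, a closed subspace `U` that contains an open subspace `V` up to
finite dimension is open: among the images of the open subspaces of `V` in `M / U` there is one of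
least dimension, and it must vanish because `U` is closed. -/
theorem Submodule.mem_nhds_zero_of_isClosed_of_almostLE {k M : Type*} [Field k] [AddCommGroup M]
    [Module k M] [TopologicalSpace M] [IsTopologicalAddGroup M] [IsLinearTopology k M]
    {U V : Submodule k M} (hU : IsClosed (U : Set M)) (hV : (V : Set M) ∈ 𝓝 0)
    (h : AlmostLE V U) : (U : Set M) ∈ 𝓝 0 := by
  classical
  rw [AlmostLE.iff_finiteDimensional_map_mkQ] at h
  have hex : ∃ n, ∃ W : Submodule k M, (W : Set M) ∈ 𝓝 0 ∧ W ≤ V ∧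
      Module.finrank k (W.map U.mkQ) = n := ⟨_, V, hV, le_rfl, rfl⟩
  obtain ⟨W, hW, hWV, hWn⟩ := Nat.find_spec hex
  refine Filter.mem_of_superset hW fun w hw => by_contra fun hwU => ?_
  have hopen : {g : M | w - g ∉ U} ∈ 𝓝 0 :=
    (hU.isOpen_compl.preimage (continuous_const.sub continuous_id)).mem_nhds (by simpa using hwU)
  obtain ⟨W', hW', hW'U⟩ := (IsLinearTopology.hasBasis_submodule k).mem_iff.mp hopen
  refine Nat.find_min hex ?_
    ⟨W ⊓ W', Filter.inter_mem hW hW', inf_le_left.trans hWV, rfl⟩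
  have hfin : FiniteDimensional k (W.map U.mkQ) :=
    Submodule.finiteDimensional_of_le (Submodule.map_mono hWV)
  rw [← hWn]
  refine Submodule.finrank_lt_finrank_of_lt
    (lt_of_le_of_ne (Submodule.map_mono inf_le_left) fun heq => ?_)
  obtain ⟨y, hy, hyw⟩ := heq ▸ Submodule.mem_map_of_mem (f := U.mkQ) hw
  exact hW'U hy.2 ((Submodule.Quotient.eq U).mp hyw.symm)

/-- Group topologies are determined by the neighbourhoods of zero. -/
theorem AddEquiv.isHomeomorph_of_comap_nhds_zero {M N : Type*} [AddCommGroup M] [AddCommGroup N]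
    [TopologicalSpace M] [TopologicalSpace N] [IsTopologicalAddGroup M] [IsTopologicalAddGroup N]
    (e : M ≃+ N) (h : (𝓝 (0 : N)).comap e = 𝓝 0) : IsHomeomorph e := by
  have hind : Topology.IsInducing e := ⟨by
    refine IsTopologicalAddGroup.ext inferInstance (topologicalAddGroup_induced e) ?_
    rw [nhds_induced, map_zero, h]⟩
  exact (e.toEquiv.toHomeomorphOfIsInducing hind).isHomeomorph

end TopologyOfSubgroups

/-! ### Topologies given by commensurability -/

section CommensurabilityTopology

variable {k M N : Type*} [Field k] [AddCommGroup M] [Module k M] [AddCommGroup N] [Module k N]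

theorem nonempty_and_directed_commensurable (V : Submodule k M) :
    {W | ∃ U : Submodule k M, IsCommensurable U V ∧ U.toAddSubgroup = W}.Nonempty ∧
    ∀ W ∈ {W | ∃ U : Submodule k M, IsCommensurable U V ∧ U.toAddSubgroup = W},
    ∀ W' ∈ {W | ∃ U : Submodule k M, IsCommensurable U V ∧ U.toAddSubgroup = W},
    ∃ W'' ∈ {W | ∃ U : Submodule k M, IsCommensurable U V ∧ U.toAddSubgroup = W},
      W'' ≤ W ⊓ W' := by
  refine ⟨⟨_, V, .refl V, rfl⟩, ?_⟩
  rintro _ ⟨U, hU, rfl⟩ _ ⟨U', hU', rfl⟩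
  exact ⟨_, ⟨U ⊓ U', hU.inf hU', rfl⟩, le_rfl⟩

theorem isTopologicalAddGroup_commensurabilityTopology (V : Submodule k M) :
    @IsTopologicalAddGroup M (commensurabilityTopology V) _ :=
  isTopologicalAddGroup_topologyOfSubgroups (nonempty_and_directed_commensurable V).1
    (nonempty_and_directed_commensurable V).2

theorem hasBasis_nhds_zero_commensurabilityTopology (V : Submodule k M) :
    (@nhds M (commensurabilityTopology V) 0).HasBasis
      (fun U : Submodule k M => IsCommensurable U V) fun U => (U : Set M) := by
  have h := hasBasis_nhds_topologyOfSubgroups (nonempty_and_directed_commensurable V).1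
    (nonempty_and_directed_commensurable V).2 0
  refine h.to_hasBasis ?_ fun U hU => ⟨_, ⟨U, hU, rfl⟩, fun g hg => by simpa using hg⟩
  rintro _ ⟨U, hU, rfl⟩
  exact ⟨U, hU, fun g hg => by simpa using hg⟩

theorem isHomeomorph_commensurabilityTopology {ι : Type*} [Finite ι] {V : Submodule k M}
    {V' : Submodule k N} (e : M ≃ₗ[k] (ι → N))
    (h : IsCommensurable V ((Submodule.pi Set.univ fun _ => V').comap e.toLinearMap)) :
    @IsHomeomorph _ _ (commensurabilityTopology V)
      (@Pi.topologicalSpace _ _ fun _ => commensurabilityTopology V') e := by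
  let τ := commensurabilityTopology V
  let τ' := commensurabilityTopology V'
  have := isTopologicalAddGroup_commensurabilityTopology V
  have := isTopologicalAddGroup_commensurabilityTopology V'
  refine e.toAddEquiv.isHomeomorph_of_comap_nhds_zero ?_
  have hb : (𝓝 (0 : ι → N)).HasBasis
      (fun U : Submodule k (ι → N) => IsCommensurable U (Submodule.pi Set.univ fun _ => V'))
      fun U => (U : Set (ι → N)) := by
    rw [nhds_pi]
    refine (Filter.hasBasis_pi
      fun _ => hasBasis_nhds_zero_commensurabilityTopology V').to_hasBasis ?_ ?_
    · rintro ⟨I, W⟩ ⟨-, hW⟩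
      classical
      refine ⟨Submodule.pi Set.univ fun i => if i ∈ I then W i else V', .pi fun i => ?_,
        fun a ha i hi => ?_⟩
      · split_ifs with hi
        · exact hW i hi
        · exact .refl V'
      · simpa [hi] using ha i trivial
    · intro U hU
      obtain ⟨W, hW, hWU⟩ := hU.exists_pi_le
      exact ⟨(Set.univ, W), ⟨Set.finite_univ, fun i _ => hW i⟩, hWU⟩
  refine (hb.comap e).eq_of_same_basis ?_
  refine (hasBasis_nhds_zero_commensurabilityTopology V).to_hasBasis (fun U hU => ?_)
    fun U hU => ⟨_, (hU.comap e.toLinearMap).trans h.symm, le_rfl⟩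
  refine ⟨U.comap e.symm.toLinearMap, ?_, fun m hm => by simpa using hm⟩
  have h1 := (hU.trans h).comap e.symm.toLinearMap
  rwa [← Submodule.comap_comp, LinearEquiv.comp_coe, LinearEquiv.symm_trans_self,
    LinearEquiv.refl_toLinearMap, Submodule.comap_id] at h1

end CommensurabilityTopology

/-! ### Residue fields at closed points -/

section ResidueFields

/-- Projective space is of finite type over the degree `0` part of its coordinate ring, which
consists of the constants. -/
theorem IsProjectiveOver.locallyOfFiniteType {k : Type u} [Field k] {X : Scheme.{u}}
    [X.Over (Spec (.of k))] (hX : IsProjectiveOver k X) :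
    LocallyOfFiniteType (X ↘ Spec (.of k)) := by
  obtain ⟨m, i, hi, h⟩ := hX
  rw [← h]
  let 𝒜 := MvPolynomial.homogeneousSubmodule (Fin (m + 1)) k
  let _ := MvPolynomial.gradedAlgebra (σ := Fin (m + 1)) (R := k)
  -- A homogeneous polynomial of degree `0` is constant.
  have hsurj : Function.Surjective (algebraMap k (𝒜 0)) := by
    rintro ⟨f, hf⟩
    have hf' : f ∈ MvPolynomial.homogeneousSubmodule (Fin (m + 1)) k 0 := hf
    rw [MvPolynomial.homogeneousSubmodule_zero, Submodule.mem_one] at hf'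
    obtain ⟨c, hc⟩ := hf'
    exact ⟨c, Subtype.ext hc⟩
  have htower : IsScalarTower k (𝒜 0) (MvPolynomial (Fin (m + 1)) k) :=
    IsScalarTower.of_algebraMap_eq (R := k) (S := 𝒜 0) fun _ => rfl
  have hft : Algebra.FiniteType (𝒜 0) (MvPolynomial (Fin (m + 1)) k) :=
    .of_restrictScalars_finiteType k _ _
  have h1 : LocallyOfFiniteType (Proj.toSpecZero 𝒜) := inferInstance
  have h2 : LocallyOfFiniteType (Spec.map (CommRingCat.ofHom (algebraMap k (𝒜 0)))) := by
    rw [HasRingHomProperty.Spec_iff (P := @LocallyOfFiniteType)]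
    exact RingHom.FiniteType.of_surjective _ hsurj
  have h3 : LocallyOfFiniteType (projSpaceToSpec k m) := by
    exact MorphismProperty.comp_mem _ _ _ h1 h2
  infer_instance

theorem fromSpecStalk_comp_over {k : Type u} [Field k] (X : Scheme.{u}) [X.Over (Spec (.of k))]
    (x : X) : X.fromSpecStalk x ≫ (X ↘ Spec (.of k)) =
      Spec.map (CommRingCat.ofHom (constToStalk k X x)) := by
  obtain ⟨φ, hφ⟩ := Spec.map_surjective (X.fromSpecStalk x ≫ (X ↘ Spec (.of k)))
  rw [← hφ]
  congr 1
  have h := Scheme.ΓSpecIso_naturality φ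
  rw [hφ, Scheme.Hom.comp_appTop, Scheme.fromSpecStalk_appTop] at h
  rw [← cancel_epi (Scheme.ΓSpecIso (.of k)).hom, ← h]
  ext c
  simp [constToStalk]

variable {k : Type u} [Field k] [IsAlgClosed k] {X : Scheme.{u}} [X.Over (Spec (.of k))]

/-- By the Nullstellensatz, the residue field at a closed point consists of constants. -/
theorem exists_sub_constToStalk_mem_maximalIdeal [LocallyOfFiniteType (X ↘ Spec (.of k))]
    (x : ClosedPoint X) (f : X.presheaf.stalk x.1) :
    ∃ c : k, f - constToStalk k X x.1 c ∈ IsLocalRing.maximalIdeal (X.presheaf.stalk x.1) := by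
  let e := residueFieldIsoBase (X ↘ Spec (.of k)) x.1 x.2
  have he : e.inv = CommRingCat.ofHom (constToStalk k X x.1) ≫ X.residue x.1 := by
    apply Spec.map_injective
    rw [SpecMap_residueFieldIsoBase_inv, Spec.map_comp, ← fromSpecStalk_comp_over]
    rfl
  refine ⟨e.hom.hom ((X.residue x.1).hom f), ?_⟩
  rw [← IsLocalRing.residue_eq_zero_iff, map_sub, sub_eq_zero]
  have h1 : e.inv.hom (e.hom.hom ((X.residue x.1).hom f)) = (X.residue x.1).hom f :=
    CategoryTheory.Iso.hom_inv_id_apply e _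
  rw [he] at h1
  exact h1.symm

variable [IsNonsingularCurve X]

/-- `A_x = k + 𝔪_x`: an element of `A_x` is approximated by an element of the function field, that
one by an element of `𝒪_x`, and this in turn by a constant. -/
theorem exists_sub_const_valued_lt_one [LocallyOfFiniteType (X ↘ Spec (.of k))]
    (x : ClosedPoint X) {a : LocalField X x} (ha : a ∈ localIntegers X x) :
    ∃ c : k, Valued.v (a - algebraMap k (Adele X) c x) < 1 := by
  have hnhds : {y : LocalField X x | Valued.v (y - a) < 1} ∈ 𝓝 a :=
    Valued.mem_nhds.mpr ⟨1, fun y hy => by simpa using hy⟩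
  obtain ⟨_, hf, f, rfl⟩ := mem_closure_iff_nhds.mp
    (HeightOneSpectrum.denseRange_algebraMap X.functionField (place X x) a) _ hnhds
  have hval (g : X.functionField) : Valued.v (algebraMap _ (LocalField X x) g) =
      (place X x).valuation X.functionField g :=
    HeightOneSpectrum.valuedAdicCompletion_eq_valuation' _ g
  have hf1 : (place X x).valuation X.functionField f ≤ 1 := by
    rw [← hval, ← sub_add_cancel (algebraMap _ (LocalField X x) f) a]
    exact (Valued.v.map_add _ _).trans (max_le (le_of_lt hf) ha)
  obtain ⟨r, hr⟩ := (place X x).exists_valuation_sub_lt_of_integer hf1 1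
  obtain ⟨c, hc⟩ := exists_sub_constToStalk_mem_maximalIdeal (k := k) x r
  refine ⟨c, ?_⟩
  have h3 : (place X x).valuation X.functionField
      (algebraMap _ _ (r - constToStalk k X x.1 c)) < 1 :=
    ((place X x).valuation_lt_one_iff_mem _).mpr hc
  have h : algebraMap k (Adele X) c x - a =
      (algebraMap _ (LocalField X x) f - a) +
      (algebraMap _ (LocalField X x) (algebraMap _ X.functionField r - f) -
      algebraMap _ (LocalField X x)
        (algebraMap _ X.functionField (r - constToStalk k X x.1 c))) := by
    have h4 : algebraMap k (Adele X) c x = algebraMap X.functionField (LocalField X x)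
      (algebraMap _ X.functionField (constToStalk k X x.1 c)) := rfl
    rw [h4]
    simp only [map_sub]
    ring
  rw [Valuation.map_sub_swap, h]
  refine Valued.v.map_add_lt hf (Valued.v.map_sub_lt ?_ ?_)
  · rw [hval]
    exact hr
  · rw [hval]
    exact h3

end ResidueFields

/-! ### Commensurability of the multiples of `𝔸_X⁺` -/

section AdeleCommensurability

variable {X : Scheme.{u}} [IsNonsingularCurve X]

variable {k : Type u} [Field k] [IsAlgClosed k] [X.Over (Spec (.of k))]
  [LocallyOfFiniteType (X ↘ Spec (.of k))]

/-- If `c` is a uniformizer at `x` and trivial elsewhere, then `𝔸_X⁺ = c 𝔸_X⁺ + k`, since the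
residue field at `x` is `k`. -/
theorem almostLE_map_mulLeft_of_irreducible {c : Adele X} (hc : c ∈ integralIdeles X)
    {x : ClosedPoint X} {ϖ : localIntegers X x} (hϖ : Irreducible ϖ) (hcx : c x = ϖ)
    (hcy : ∀ y ≠ x, c y = 1) :
    AlmostLE (integralAdeleSubspace k X)
      ((integralAdeleSubspace k X).map (LinearMap.mulLeft k c)) := by
  refine ⟨Submodule.span k {1}, Submodule.fg_span_singleton _, fun a ha => ?_⟩
  obtain ⟨r, hr⟩ := exists_sub_const_valued_lt_one (k := k) x ((mem_integralAdele X).mp ha x)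
  refine Submodule.mem_sup.mpr ⟨a - algebraMap k (Adele X) r, ?_, algebraMap k (Adele X) r, ?_,
    sub_add_cancel _ _⟩
  · have har : a - algebraMap k (Adele X) r ∈ integralAdele X :=
      sub_mem ha (constToAdele_mem_integralAdele k X r)
    refine exists_mul_eq_of_mul_inv_mem (isUnit_of_mem_integralIdeles hc) fun y => ?_
    rcases eq_or_ne y x with rfl | hy
    · have hmax : (⟨_, (mem_integralAdele X).mp har y⟩ : localIntegers X y) ∈
          IsLocalRing.maximalIdeal (localIntegers X y) :=
        (Valuation.mem_maximalIdeal_iff _ _).mpr hr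
      rw [hϖ.maximalIdeal_eq, Ideal.mem_span_singleton] at hmax
      obtain ⟨b, hb⟩ := hmax
      have hb' : (a - algebraMap k (Adele X) r) y = c y * b := by
        rw [hcx]
        exact congrArg Subtype.val hb
      rw [hb', inv_mul_cancel_left₀ (apply_ne_zero_of_mem_integralIdeles hc y)]
      exact b.2
    · rw [hcy y hy, inv_one, one_mul]
      exact (mem_integralAdele X).mp har y
  · rw [Algebra.algebraMap_eq_smul_one]
    exact Submodule.smul_mem _ _ (Submodule.mem_span_singleton_self _)

theorem almostLE_map_mulLeft_mul {k A : Type*} [Field k] [CommRing A] [Algebra k A]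
    {V : Submodule k A} {c d : A} (hc : AlmostLE V (V.map (LinearMap.mulLeft k c)))
    (hd : AlmostLE V (V.map (LinearMap.mulLeft k d))) :
    AlmostLE V (V.map (LinearMap.mulLeft k (c * d))) := by
  rw [LinearMap.mulLeft_mul, Submodule.map_comp]
  exact hc.trans (hd.map _)

/-- Every integral idele divides a product of local uniformizers. -/
theorem almostLE_map_mulLeft {c : Adele X} (hc : c ∈ integralIdeles X) :
    AlmostLE (integralAdeleSubspace k X)
      ((integralAdeleSubspace k X).map (LinearMap.mulLeft k c)) := by
  classical
  choose ϖ hϖ using fun x : ClosedPoint X =>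
    IsDiscreteValuationRing.exists_irreducible (localIntegers X x)
  have hidele (x : ClosedPoint X) := exists_mem_integralIdeles_apply
    (Function.update (1 : ∀ y, LocalField X y) x (ϖ x))
    (fun y => by
      rcases eq_or_ne y x with rfl | hy
      · rw [Function.update_self]
        exact fun h => (hϖ y).ne_zero (Subtype.ext h)
      · rw [Function.update_of_ne hy]
        exact one_ne_zero)
    (fun y => by
      rcases eq_or_ne y x with rfl | hy
      · rw [Function.update_self]
        exact (ϖ y).2
      · rw [Function.update_of_ne hy]
        exact one_mem _)
    (by
      filter_upwards [(Set.finite_singleton x).compl_mem_cofinite] with y hy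
      rw [Function.update_of_ne hy, Pi.one_apply, inv_one]
      exact one_mem _)
  choose π hπ hπe using hidele
  have hmul (x : ClosedPoint X) : ∃ n : ℕ, (ϖ x : LocalField X x) ^ n * (c x)⁻¹ ∈
      localIntegers X x := by
    have hcx := apply_ne_zero_of_mem_integralIdeles hc x
    obtain ⟨n, u, hu⟩ := IsDiscreteValuationRing.eq_unit_mul_pow_irreducible
      (x := (⟨c x, (mem_integralAdele X).mp (mem_integralAdele_of_mem_integralIdeles hc) x⟩ :
        localIntegers X x)) (fun h => hcx (congrArg Subtype.val h)) (hϖ x)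
    refine ⟨n, ?_⟩
    have h1 : (ϖ x : LocalField X x) ^ n = ((u⁻¹ : (localIntegers X x)ˣ) : localIntegers X x) *
        c x := by
      have h2 : ϖ x ^ n = ((u⁻¹ : (localIntegers X x)ˣ) : localIntegers X x) *
          ⟨c x, (mem_integralAdele X).mp (mem_integralAdele_of_mem_integralIdeles hc) x⟩ := by
        rw [hu, Units.inv_mul_cancel_left]
      exact congrArg Subtype.val h2
    rw [h1, mul_inv_cancel_right₀ hcx]
    exact Subtype.property _
  choose n hn using hmul
  have hfin := Filter.eventually_cofinite.mp (eventually_inv_apply_mem_of_mem_integralIdeles hc)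
  have hπpow (x : ClosedPoint X) : π x ^ n x ∈ integralIdeles X := pow_mem (hπ x) _
  let d := ∏ x ∈ hfin.toFinset, π x ^ n x
  have hd : AlmostLE (integralAdeleSubspace k X)
      ((integralAdeleSubspace k X).map (LinearMap.mulLeft k d)) := by
    have hone : AlmostLE (integralAdeleSubspace k X)
        ((integralAdeleSubspace k X).map (LinearMap.mulLeft k 1)) := by
      rw [LinearMap.mulLeft_one, Submodule.map_id]
      exact .of_le le_rfl
    refine Finset.prod_induction _ (fun e => AlmostLE (integralAdeleSubspace k X)
      ((integralAdeleSubspace k X).map (LinearMap.mulLeft k e)))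
      (fun _ _ => almostLE_map_mulLeft_mul) hone fun x _ => ?_
    induction n x with
    | zero => rwa [pow_zero]
    | succ m ih =>
      rw [pow_succ]
      refine almostLE_map_mulLeft_mul ih (almostLE_map_mulLeft_of_irreducible (hπ x) (hϖ x) ?_ ?_)
      · rw [hπe, Function.update_self]
      · intro y hy
        rw [hπe, Function.update_of_ne hy]
        rfl
  refine hd.trans (.of_le ?_)
  rintro _ ⟨b, hb, rfl⟩
  refine exists_mul_eq_of_mul_inv_mem (isUnit_of_mem_integralIdeles hc) fun y => ?_
  have hby := (mem_integralAdele X).mp hb y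
  change (c y)⁻¹ * (d y * b y) ∈ _
  rw [← mul_assoc]
  refine mul_mem ?_ hby
  by_cases hy : (c y)⁻¹ ∈ localIntegers X y
  · exact mul_mem hy ((mem_integralAdele X).mp (mem_integralAdele_of_mem_integralIdeles
      (prod_mem fun x _ => hπpow x)) y)
  · have hdy : d y = ((ϖ y : LocalField X y) ^ n y) *
        (∏ x ∈ hfin.toFinset.erase y, π x ^ n x : Adele X) y := by
      have h1 : (π y ^ n y) y = (ϖ y : LocalField X y) ^ n y := by
        change π y y ^ n y = _
        rw [hπe, Function.update_self]
      rw [← h1]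
      exact congrArg (Adele.eval X y)
        (Finset.mul_prod_erase hfin.toFinset (fun x => π x ^ n x) (by simpa using hy)).symm
    rw [hdy, ← mul_assoc, mul_comm (c y)⁻¹]
    exact mul_mem (hn y) ((mem_integralAdele X).mp (mem_integralAdele_of_mem_integralIdeles
      (prod_mem fun x _ => hπpow x)) y)

end AdeleCommensurability

/-! ### Neighbourhoods of zero in `𝔸_X` -/

section AdeleTopology

variable {X : Scheme.{u}} [IsNonsingularCurve X]

instance fact_isOpen_localIntegers :
    Fact (∀ x : ClosedPoint X, IsOpen (localIntegers X x : Set (LocalField X x))) :=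
  ⟨fun x => Valued.isOpen_valuationSubring (LocalField X x)⟩

theorem exists_ne_zero_forall_mul_mem {x : ClosedPoint X} {s : Set (localIntegers X x)}
    (hs : s ∈ 𝓝 0) : ∃ e : localIntegers X x, e ≠ 0 ∧ ∀ b, e * b ∈ s := by
  rw [nhds_subtype, Filter.mem_comap] at hs
  obtain ⟨t, ht, hts⟩ := hs
  obtain ⟨γ, hγ⟩ := Valued.mem_nhds_zero.mp ht
  obtain ⟨ϖ, hϖ⟩ := IsDiscreteValuationRing.exists_irreducible (localIntegers X x)
  have hϖ1 : Valued.v (ϖ : LocalField X x) < 1 :=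
    (Valuation.mem_maximalIdeal_iff _ _).mp
      ((IsLocalRing.mem_maximalIdeal _).mpr hϖ.not_isUnit)
  obtain ⟨n, hn⟩ := ((Valued.tendsto_zero_pow_of_v_lt_one hϖ1).eventually
    (Valued.mem_nhds_zero.mpr ⟨γ, subset_rfl⟩)).exists
  refine ⟨ϖ ^ n, pow_ne_zero _ hϖ.ne_zero, fun b => hts (hγ ?_)⟩
  refine lt_of_le_of_lt (Valued.v.restrict_le_iff.mpr ?_) hn
  change Valued.v ((ϖ : LocalField X x) ^ n * b) ≤ _
  rw [map_mul]
  exact mul_le_of_le_one_right' b.2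

theorem hasBasis_nhds_zero_adele :
    (𝓝 (0 : Adele X)).HasBasis (· ∈ integralIdeles X)
      fun c => {a | ∃ b ∈ integralAdele X, c * b = a} := by
  classical
  refine ⟨fun s => ⟨fun hs => ?_, ?_⟩⟩
  -- A neighbourhood of `0` in `∏ A_x` restricts only finitely many components.
  · have h := RestrictedProduct.nhds_zero_eq_map_structureMap
      (R := LocalField X) (B := localIntegers X) fact_isOpen_localIntegers.out
    have hs' : RestrictedProduct.structureMap (LocalField X) (fun x => (localIntegers X x : Set _))
        Filter.cofinite ⁻¹' s ∈ 𝓝 0 := by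
      rw [← Filter.mem_map, ← h]
      exact hs
    rw [nhds_pi, Filter.mem_pi] at hs'
    obtain ⟨I, hI, t, ht, hIt⟩ := hs'
    choose e he0 he using fun x => exists_ne_zero_forall_mul_mem (ht x)
    obtain ⟨c, hc, hce⟩ := exists_mem_integralIdeles_apply
      (fun x => if x ∈ I then (e x : LocalField X x) else 1)
      (fun x => by
        split_ifs
        · exact fun h => he0 x (Subtype.ext h)
        · exact one_ne_zero)
      (fun x => by
        split_ifs
        · exact (e x).2
        · exact one_mem _)
      (by
        filter_upwards [hI.compl_mem_cofinite] with x hx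
        rw [if_neg hx, inv_one]
        exact one_mem _)
    refine ⟨c, hc, ?_⟩
    rintro _ ⟨b, hb, rfl⟩
    have hcb := (mem_integralAdele X).mp
      (mul_mem (mem_integralAdele_of_mem_integralIdeles hc) hb)
    have hmem : (fun x => (⟨(c * b) x, hcb x⟩ : localIntegers X x)) ∈ I.pi t := fun x hx => by
      have h1 : (⟨(c * b) x, hcb x⟩ : localIntegers X x) =
          e x * ⟨b x, (mem_integralAdele X).mp hb x⟩ := Subtype.ext <| by
        change c x * b x = e x * b x
        rw [hce, if_pos hx]
      dsimp only
      rw [h1]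
      exact he x _
    exact hIt hmem
  -- `c 𝔸_X⁺` is the preimage of the open set `𝔸_X⁺` under multiplication by `c⁻¹`.
  · rintro ⟨c, hc, hcs⟩
    obtain ⟨d, hd⟩ := (isUnit_of_mem_integralIdeles hc).exists_right_inv
    have hopen : IsOpen {a : Adele X | ∀ x, a x ∈ localIntegers X x} :=
      RestrictedProduct.isOpen_forall_mem fact_isOpen_localIntegers.out
    have hpre : {a : Adele X | ∀ x, (d * a) x ∈ localIntegers X x} ∈ 𝓝 0 := by
      refine (hopen.preimage (continuous_const_mul d)).mem_nhds fun x => ?_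
      change (d * 0) x ∈ _
      rw [mul_zero]
      exact zero_mem _
    refine Filter.mem_of_superset hpre fun a ha => hcs ?_
    exact ⟨d * a, (mem_integralAdele X).mpr ha, by rw [← mul_assoc, hd, one_mul]⟩

end AdeleTopology

/-! ### The topology of `𝔸_X{p}` -/

section AdelicAlgebraTopology

variable {X : Scheme.{u}} [IsNonsingularCurve X] {p : Polynomial (Adele X)}

theorem nonempty_and_directed_divisorSubgroup (p : Polynomial (Adele X)) :
    (Set.range (divisorSubgroup p)).Nonempty ∧
    ∀ U ∈ Set.range (divisorSubgroup p), ∀ V ∈ Set.range (divisorSubgroup p),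
      ∃ W ∈ Set.range (divisorSubgroup p), W ≤ U ⊓ V := by
  refine ⟨Set.range_nonempty _, ?_⟩
  rintro _ ⟨D, rfl⟩ _ ⟨E, rfl⟩
  refine ⟨_, ⟨D + E, rfl⟩, fun α hα => ?_⟩
  rw [mem_divisorSubgroup] at hα
  refine ⟨mem_divisorSubgroup.mpr fun x => ?_, mem_divisorSubgroup.mpr fun x => ?_⟩ <;>
    obtain ⟨b, hb, hbα⟩ := hα x
  · exact ⟨b, Ideal.pow_le_pow_right (Nat.le_add_right _ _) hb, hbα⟩
  · exact ⟨b, Ideal.pow_le_pow_right (Nat.le_add_left _ _) hb, hbα⟩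

instance isTopologicalAddGroup_adelicAlgebra : IsTopologicalAddGroup (AdjoinRoot p) :=
  isTopologicalAddGroup_topologyOfSubgroups (nonempty_and_directed_divisorSubgroup p).1
    (nonempty_and_directed_divisorSubgroup p).2

theorem hasBasis_nhds_zero_adelicAlgebra (p : Polynomial (Adele X)) :
    (𝓝 (0 : AdjoinRoot p)).HasBasis (fun _ : ClosedPoint X →₀ ℕ => True)
      fun D => (divisorSubgroup p D : Set (AdjoinRoot p)) := by
  have h := hasBasis_nhds_topologyOfSubgroups (nonempty_and_directed_divisorSubgroup p).1
    (nonempty_and_directed_divisorSubgroup p).2 0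
  refine h.to_hasBasis ?_ fun D _ => ⟨_, ⟨D, rfl⟩, fun g hg => by simpa using hg⟩
  rintro _ ⟨D, rfl⟩
  exact ⟨D, trivial, fun g hg => by simpa using hg⟩

theorem hasBasis_nhds_zero_pi_adele (ι : Type*) [Finite ι] :
    (𝓝 (0 : ι → Adele X)).HasBasis (· ∈ integralIdeles X)
      fun c => {a | ∀ i, ∃ b ∈ integralAdele X, c * b = a i} := by
  rw [nhds_pi]
  refine (Filter.hasBasis_pi fun _ : ι => hasBasis_nhds_zero_adele (X := X)).to_hasBasis ?_ ?_
  · rintro ⟨I, c⟩ ⟨hI, hc⟩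
    refine ⟨∏ i ∈ hI.toFinset, c i, prod_mem fun i hi => hc i (hI.mem_toFinset.mp hi),
      fun a ha i hi => ?_⟩
    classical
    obtain ⟨b, hb, hba⟩ := ha i
    refine ⟨(∏ j ∈ hI.toFinset.erase i, c j) * b, mul_mem (prod_mem fun j hj => ?_) hb, ?_⟩
    · exact mem_integralAdele_of_mem_integralIdeles
        (hc j (hI.mem_toFinset.mp (Finset.mem_of_mem_erase hj)))
    · rw [← hba, ← mul_assoc, Finset.mul_prod_erase _ _ (hI.mem_toFinset.mpr hi)]
  · intro c hc
    exact ⟨(Set.univ, fun _ => c), ⟨Set.finite_univ, fun _ _ => hc⟩, fun a ha i => ha i trivial⟩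

theorem eq_smul_coordEquiv_symm {R : Type*} [CommRing R] {p : Polynomial R} (hp : p.Monic) {c : R}
    {α : AdjoinRoot p} {b : Fin p.natDegree → R} (h : ∀ i, c * b i = coordEquiv hp α i) :
    α = c • (coordEquiv hp).symm b := by
  apply (coordEquiv hp).injective
  rw [map_smul, LinearEquiv.apply_symm_apply]
  exact funext fun i => (h i).symm

theorem comap_coordEquiv_nhds_zero (hp : p.Monic) (hsep : p.Separable) :
    (𝓝 (0 : Fin p.natDegree → Adele X)).comap (coordEquiv hp) = 𝓝 0 := by
  refine ((hasBasis_nhds_zero_pi_adele (X := X) (Fin p.natDegree)).comap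
    (coordEquiv hp)).eq_of_same_basis ?_
  refine (hasBasis_nhds_zero_adelicAlgebra p).to_hasBasis (fun D _ => ?_) fun c hc => ?_
  · obtain ⟨c, hc, hcD⟩ := exists_smul_mem_divisorSubgroup hp hsep D
    refine ⟨c, hc, fun α hα => ?_⟩
    choose b hb hbα using hα
    rw [eq_smul_coordEquiv_symm hp hbα]
    refine hcD _ fun i => ?_
    rw [LinearEquiv.apply_symm_apply]
    exact hb i
  · obtain ⟨D, hD⟩ := exists_divisorSubgroup_le hp hsep hc
    exact ⟨D, trivial, hD⟩

theorem isHomeomorph_coordEquiv (hp : p.Monic) (hsep : p.Separable) :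
    IsHomeomorph (coordEquiv hp) :=
  (coordEquiv hp).toAddEquiv.isHomeomorph_of_comap_nhds_zero (comap_coordEquiv_nhds_zero hp hsep)

theorem continuousSMul_adelicAlgebra (hp : p.Monic) (hsep : p.Separable) :
    ContinuousSMul (Adele X) (AdjoinRoot p) :=
  (isHomeomorph_coordEquiv hp hsep).isInducing.continuousSMul continuous_id
    fun {c α} => map_smul (coordEquiv hp) c α

variable (k : Type u) [Field k] [X.Over (Spec (.of k))]

/-- The `k`-subspace of `𝔸_X{p}` of the elements with coordinates in `c 𝔸_X⁺`. -/
noncomputable def coordLattice (hp : p.Monic) (c : Adele X) : Submodule k (AdjoinRoot p) :=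
  (Submodule.pi Set.univ fun _ =>
    (integralAdeleSubspace k X).map (LinearMap.mulLeft k c)).comap
      ((coordEquiv hp).restrictScalars k).toLinearMap

variable {k}

theorem mem_coordLattice {hp : p.Monic} {c : Adele X} {α : AdjoinRoot p} :
    α ∈ coordLattice k hp c ↔ ∀ i, ∃ b ∈ integralAdele X, c * b = coordEquiv hp α i :=
  ⟨fun h i => h i trivial, fun h i _ => h i⟩

theorem hasBasis_nhds_zero_coordLattice (hp : p.Monic) (hsep : p.Separable) :
    (𝓝 (0 : AdjoinRoot p)).HasBasis (· ∈ integralIdeles X)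
      fun c => (coordLattice k hp c : Set (AdjoinRoot p)) := by
  rw [← comap_coordEquiv_nhds_zero hp hsep]
  convert (hasBasis_nhds_zero_pi_adele (X := X) (Fin p.natDegree)).comap (coordEquiv hp) using 2
  ext α
  exact mem_coordLattice

theorem isLinearTopology_adelicAlgebra (hp : p.Monic) (hsep : p.Separable) :
    IsLinearTopology k (AdjoinRoot p) :=
  .mk_of_hasBasis k (hasBasis_nhds_zero_coordLattice hp hsep)

theorem coordLattice_le_coordLattice_one (hp : p.Monic) {c : Adele X} (hc : c ∈ integralAdele X) :
    coordLattice k hp c ≤ coordLattice k hp 1 := fun α hα => mem_coordLattice.mpr fun i => by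
  obtain ⟨b, hb, hbα⟩ := mem_coordLattice.mp hα i
  exact ⟨c * b, mul_mem hc hb, by rw [one_mul, hbα]⟩

theorem mem_integralSubspace {α : AdjoinRoot p} : α ∈ integralSubspace p k ↔
    α ∈ integralClosure (integralAdele X) (AdjoinRoot p) := Iff.rfl

theorem coordLattice_le_integralSubspace (hp : p.Monic) {c : Adele X}
    (hc : ∀ α : AdjoinRoot p, (∀ i, coordEquiv hp α i ∈ integralAdele X) →
      c • α ∈ integralClosure (integralAdele X) (AdjoinRoot p)) :
    coordLattice k hp c ≤ integralSubspace p k := fun α hα => by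
  choose b hb hbα using mem_coordLattice.mp hα
  rw [eq_smul_coordEquiv_symm hp hbα]
  exact hc _ fun i => by rw [LinearEquiv.apply_symm_apply]; exact hb i

variable (k p) in
/-- Multiplication by `c` on `𝔸_X{p}`. -/
noncomputable def smulMap (c : Adele X) : AdjoinRoot p →ₗ[k] AdjoinRoot p :=
  (LinearMap.lsmul (Adele X) (AdjoinRoot p) c).restrictScalars k

theorem coordEquiv_smulMap (hp : p.Monic) (c : Adele X) (α : AdjoinRoot p) (i : Fin p.natDegree) :
    coordEquiv hp (smulMap p k c α) i = c * coordEquiv hp α i :=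
  congrFun (map_smul (coordEquiv hp) c α) i

theorem integralSubspace_le_comap_smulMap (hp : p.Monic) {c : Adele X}
    (hc : ∀ (x : ClosedPoint X), ∀ β ∈ localClosure p x, ∀ i,
      c x * coordEquiv (hp.map (Adele.eval X x)) β i ∈ localIntegers X x) :
    integralSubspace p k ≤ (coordLattice k hp 1).comap (smulMap p k c) := fun α hα =>
  Submodule.mem_comap.mpr <| mem_coordLattice.mpr fun i => by
    refine ⟨c * coordEquiv hp α i, (mem_integralAdele X).mpr fun x => ?_, ?_⟩
    · have h := hc x _ (toLocal_mem_localClosure x (mem_integralSubspace.mp hα))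
        (Fin.cast (natDegree_localPoly hp x).symm i)
      rwa [coordEquiv_toLocal] at h
    · rw [one_mul, coordEquiv_smulMap]

theorem comap_smulMap_coordLattice_le (hp : p.Monic) {c d : Adele X} (hc : IsUnit c) :
    (coordLattice k hp (c * d)).comap (smulMap p k c) ≤ coordLattice k hp d := fun α hα =>
  mem_coordLattice.mpr fun i => by
    obtain ⟨b, hb, hbα⟩ := mem_coordLattice.mp (Submodule.mem_comap.mp hα) i
    refine ⟨b, hb, hc.mul_left_cancel ?_⟩
    rw [← mul_assoc, hbα, coordEquiv_smulMap]

variable [IsAlgClosed k] [LocallyOfFiniteType (X ↘ Spec (.of k))]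

theorem almostLE_coordLattice (hp : p.Monic) {c : Adele X} (hc : c ∈ integralIdeles X) :
    AlmostLE (coordLattice k hp 1) (coordLattice k hp c) := by
  refine AlmostLE.comap _ (AlmostLE.pi fun _ => ?_)
  rw [LinearMap.mulLeft_one, Submodule.map_id]
  exact almostLE_map_mulLeft hc

/-- With the idele `c₀` of `exists_integralIdele_bounds`, the integral closure `𝔸_X{p}⁺` contains
the lattice of `c₀` and is contained in that of `c₀⁻¹`, and these are commensurable. -/
theorem isCommensurable_coordLattice (hp : p.Monic) (hsep : p.Separable) {c : Adele X}
    (hc : c ∈ integralIdeles X) :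
    IsCommensurable (coordLattice k hp c) (integralSubspace p k) := by
  obtain ⟨c₀, hc₀, hlower, hupper⟩ := exists_integralIdele_bounds hp hsep
  rw [isCommensurable_iff_almostLE]
  constructor
  · exact (AlmostLE.of_le (coordLattice_le_coordLattice_one hp
      (mem_integralAdele_of_mem_integralIdeles hc))).trans ((almostLE_coordLattice hp hc₀).trans
        (.of_le (coordLattice_le_integralSubspace hp hlower)))
  · exact (AlmostLE.of_le (integralSubspace_le_comap_smulMap hp hupper)).trans
      (((almostLE_coordLattice hp (mul_mem hc₀ hc)).comap (smulMap p k c₀)).trans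
        (.of_le (comap_smulMap_coordLattice_le hp (isUnit_of_mem_integralIdeles hc₀))))

theorem hasBasis_nhds_zero_isClosed_isCommensurable (hp : p.Monic) (hsep : p.Separable) :
    (𝓝 (0 : AdjoinRoot p)).HasBasis
      (fun U : Submodule k (AdjoinRoot p) =>
        IsClosed (U : Set (AdjoinRoot p)) ∧ IsCommensurable U (integralSubspace p k))
      (fun U => (U : Set (AdjoinRoot p))) := by
  have hb := hasBasis_nhds_zero_coordLattice (k := k) hp hsep
  have := isLinearTopology_adelicAlgebra (k := k) hp hsep
  refine ⟨fun s => ⟨fun hs => ?_, ?_⟩⟩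
  · obtain ⟨c, hc, hcs⟩ := hb.mem_iff.mp hs
    refine ⟨coordLattice k hp c, ⟨?_, isCommensurable_coordLattice hp hsep hc⟩, hcs⟩
    exact (coordLattice k hp c).toAddSubgroup.isClosed_of_isOpen
      ((coordLattice k hp c).toAddSubgroup.isOpen_of_mem_nhds (hb.mem_of_mem hc))
  · rintro ⟨U, ⟨hU, hUc⟩, hUs⟩
    refine Filter.mem_of_superset ?_ hUs
    have h1 := isCommensurable_iff_almostLE.mp
      (isCommensurable_coordLattice (k := k) hp hsep (one_mem (integralIdeles X)))
    refine Submodule.mem_nhds_zero_of_isClosed_of_almostLE hU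
      (hb.mem_of_mem (one_mem (integralIdeles X))) ?_
    exact h1.1.trans (isCommensurable_iff_almostLE.mp hUc).2

theorem isHomeomorph_coordEquiv_commensurabilityTopology (hp : p.Monic) (hsep : p.Separable) :
    @IsHomeomorph _ _ (commensurabilityTopology (integralSubspace p k))
      (@Pi.topologicalSpace _ _ fun _ => commensurabilityTopology (integralAdeleSubspace k X))
      (coordEquiv hp) := by
  have h := (isCommensurable_coordLattice (k := k) hp hsep (one_mem (integralIdeles X))).symm
  rw [coordLattice, LinearMap.mulLeft_one, Submodule.map_id] at h
  exact isHomeomorph_commensurabilityTopology ((coordEquiv hp).restrictScalars k) h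

end AdelicAlgebraTopology

theorem mainTheorem4 {k : Type u} [Field k] [IsAlgClosed k] (X : Scheme.{u})
    [X.Over (Spec (.of k))] [IsNonsingularCurve X] (hX : IsProjectiveOver k X)
    (p : Polynomial (Adele X)) (hp : p.Monic) (hsep : IsSeparablePolynomial p) :
    IsTopologicalAddGroup (AdjoinRoot p) ∧ ContinuousSMul (Adele X) (AdjoinRoot p) ∧
    IsLinearTopology k (AdjoinRoot p) ∧
    (𝓝 (0 : AdjoinRoot p)).HasBasis
      (fun U : Submodule k (AdjoinRoot p) =>
        IsClosed (U : Set (AdjoinRoot p)) ∧ IsCommensurable U (integralSubspace p k))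
      (fun U => (U : Set (AdjoinRoot p))) ∧
    ∃ ψ : AdjoinRoot p ≃ₗ[Adele X] (Fin p.natDegree → Adele X),
      (∀ (Q : Polynomial (Adele X)) (i : Fin p.natDegree),
        ψ (AdjoinRoot.mk p Q) i = (Q %ₘ p).coeff i) ∧
      IsHomeomorph ψ ∧
      @IsHomeomorph _ _ (commensurabilityTopology (integralSubspace p k))
        (@Pi.topologicalSpace _ _ fun _ => commensurabilityTopology (integralAdeleSubspace k X))
        ψ := by
  have hs := hsep.separable
  have := hX.locallyOfFiniteType
  exact ⟨inferInstance, continuousSMul_adelicAlgebra hp hs, isLinearTopology_adelicAlgebra hp hs,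
    hasBasis_nhds_zero_isClosed_isCommensurable hp hs, coordEquiv hp, coordEquiv_mk hp,
    isHomeomorph_coordEquiv hp hs, isHomeomorph_coordEquiv_commensurabilityTopology hp hs⟩
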